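/- Let $n\ge 2$, let $\mathbb B$ be the open unit ball of $\mathbb R^n$, and let $\nu$ be Lebesgue measure on $\mathbb B$ normalized so that $\nu(\mathbb B)=1$. For $\alpha>-1$ put $d\nu_\alpha(x)=\frac1{V_\alpha}(1-|x|^2)^\alpha\,d\nu(x)$, where $V_\alpha$ is chosen so that $\nu_\alpha(\mathbb B)=1$. For $0<p<\infty$ and $\alpha>-1$, let $b^p_\alpha$ be the space of complex-valued harmonic functions $f$ on $\mathbb B$ with $\|f\|_{b^p_\alpha}=\left(\int_{\mathbb B}|f|^p\,d\nu_\alpha\right)^{1/p}<\infty$. For $\alpha>0$, let $b^\infty_\alpha$ be the space of complex-valued harmonic functions $f$ on $\mathbb B$ with $\|f\|_{b^\infty_\alpha}=\sup_{x\in\mathbb B}(1-|x|^2)^\alpha|f(x)|<\infty$. For $\alpha>-1$, a positive Borel measure $\mu$ on $\mathbb B$ is called an $\alpha$-Carleson measure if, for some $0<p<\infty$, there is a constant $K$ such that $\left(\int_{\mathbb B}|f|^p\,d\mu\right)^{1/p}\le K\|f\|_{b^p_\alpha}$ for all $f\in b^p_\alpha$. **Proposition 3.2.** Let $\mu$ be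 a positive Borel measure on $\mathbb B$, let $\alpha_1>0$ and $-1<\alpha_2<\infty$, and let $\varrho=\alpha_1+\alpha_2$. If $\mu$ is a $\varrho$-Carleson measure, then there is a constant $C>0$ such that $$\int_{\mathbb B}|f(x)|\,|g(x)|\,d\mu(x)\le C\,\|f\|_{b^\infty_{\alpha_1}}\,\|g\|_{b^1_{\alpha_2}}\qquad\text{for all } f\in b^\infty_{\alpha_1},\ g\in b^1_{\alpha_2}.$$ -/

import Mathlib

open MeasureTheory Metric InnerProductSpace
open scoped ENNReal NNReal

noncomputable section

namespace HarmonicBall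

/-- The open unit ball `𝔹` of `ℝⁿ`. -/
def unitBall (n : ℕ) : Set (EuclideanSpace ℝ (Fin n)) := ball 0 1

/-- Lebesgue measure `ν` on `𝔹`, normalized so that `ν(𝔹) = 1`. -/
def nu (n : ℕ) : Measure (EuclideanSpace ℝ (Fin n)) :=
  (volume (unitBall n))⁻¹ • volume.restrict (unitBall n)

/-- The weight `(1 - |x|²)^α`. It is only ever used at points of `𝔹`, where `1 - |x|² > 0`. -/
def weight {n : ℕ} (α : ℝ) (x : EuclideanSpace ℝ (Fin n)) : ℝ := (1 - ‖x‖ ^ 2) ^ α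

open Classical in
/-- The normalizing constant `V_α`: the integral of `(1 - |x|²)^α` with respect to `ν` if `α > -1`
(where this integral is finite), and `1` otherwise. -/
def V (n : ℕ) (α : ℝ) : ℝ≥0∞ :=
  if -1 < α then ∫⁻ x, ENNReal.ofReal (weight α x) ∂(nu n) else 1

/-- The weighted volume measure `dν_α = V_α⁻¹ (1 - |x|²)^α dν` on `𝔹`. -/
def nuWeighted (n : ℕ) (α : ℝ) : Measure (EuclideanSpace ℝ (Fin n)) :=
  (V n α)⁻¹ • (nu n).withDensity (fun x => ENNReal.ofReal (weight α x))

/-- `h(𝔹)`: the complex-valued functions that are harmonic on `𝔹`. Functions are total functions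
on `ℝⁿ` whose values outside `𝔹` play no role. -/
def harmonicFunctions (n : ℕ) : Set (EuclideanSpace ℝ (Fin n) → ℂ) :=
  {f | HarmonicOnNhd f (unitBall n)}

/-- The (quasi)norm of `L^p_α = L^p(ν_α)`. -/
def bergmanNorm {n : ℕ} (p : ℝ≥0∞) (α : ℝ) (f : EuclideanSpace ℝ (Fin n) → ℂ) : ℝ≥0∞ :=
  eLpNorm f p (nuWeighted n α)

/-- The weighted harmonic Bergman space `b^p_α = h(𝔹) ∩ L^p_α`, for `0 < p < ∞`, `α > -1`. -/
def bergmanSpace (n : ℕ) (p : ℝ≥0∞) (α : ℝ) : Set (EuclideanSpace ℝ (Fin n) → ℂ) :=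
  {f | f ∈ harmonicFunctions n ∧ MemLp f p (nuWeighted n α)}

/-- The norm `‖f‖_{L^∞_α} = ‖(1 - |x|²)^α f‖_{L^∞}`, an essential supremum over `𝔹`. -/
def blochNorm {n : ℕ} (α : ℝ) (f : EuclideanSpace ℝ (Fin n) → ℂ) : ℝ≥0∞ :=
  eLpNorm (fun x => weight α x • f x) ∞ (nu n)

/-- The weighted harmonic Bloch space `b^∞_α = h(𝔹) ∩ L^∞_α`, for `α > 0`. -/
def blochSpace (n : ℕ) (α : ℝ) : Set (EuclideanSpace ℝ (Fin n) → ℂ) :=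
  {f | f ∈ harmonicFunctions n ∧ MemLp (fun x => weight α x • f x) ∞ (nu n)}

/-- `μ` is an `α`-Carleson measure, tested on `b^p_α`: the inclusion of `b^p_α` into `L^p(μ)` is
bounded. A Borel measure on `𝔹` is given as the restriction to `𝔹` of a measure on `ℝⁿ`. -/
def IsCarlesonMeasure {n : ℕ} (p : ℝ≥0∞) (α : ℝ) (μ : Measure (EuclideanSpace ℝ (Fin n))) :
    Prop :=
  ∃ C : ℝ≥0, ∀ f ∈ bergmanSpace n p α,
    eLpNorm f p (μ.restrict (unitBall n)) ≤ C * bergmanNorm p α f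

end HarmonicBall

end

/-!
A `ρ`-Carleson measure `μ`, whatever the exponent `p` it is tested on, satisfies the geometric
bound `μ (B(a, (1 - |a|) / 2)) ≤ C (1 - |a|)^(n + ρ)`
(`IsCarlesonMeasure.exists_measure_ball_le`), and this bound alone gives the product estimate.

*From Carleson to geometric.* The test functions are Kelvin transforms
`|y|^(2 - n - 2m) (⟨e, y⟩ + i⟨e', y⟩)^m`, `y = x - b`, of powers of a null linear form
(`poleKernel`, with `m = k + 2`). They are harmonic off `b` by an explicit computation, bounded by
`|y|^(-(n + k))`, and comparable to this bound near the line `b + ℝe`. With the pole `b` at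
distance `δ = 1 - |a|` from the ball, on the ray through `a`, the kernel has size `δ^(-(n + k))`
on `B(a, δ / 2)`, while the `p`-th power of its norm in `b^p_ρ` is `O(δ^(n + ρ - (n + k)p))`, as
soon as `(n + k) p > n + ρ`; it is here that small `p` forces large `k`. The norm estimate is
`exists_lintegral_pole_weight_le`. It reduces, by the layer cake formula, to the bound
`O(s^(n + ρ))` for the weighted volume of the intersection of the unit ball with a ball of
radius `s` centred outside it. For `ρ < 0` the weight is singular at the sphere, and that bound is
proved by averaging over dilations (`setLIntegral_weight_le_of_dilates`).

*From geometric to the product estimate.* Pointwise `|f| ≤ ‖f‖ (1 - |x|)^(-α₁)`, and `|g(x)|` is at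
most a constant times the mean of `|g|` over `B(x, (1 - |x|) / 4)`
(`exists_enorm_le_lintegral_ball`). By Tonelli's theorem `∫ (1 - |x|)^(-α₁) |g| dμ` is then bounded
by `∫ (1 - |y|)^(-α₁ - n) |g(y)| μ(B(y, (1 - |y|) / 2)) dy`, and the geometric bound with
`ρ = α₁ + α₂` leaves the weight `(1 - |y|)^α₂` (`exists_lintegral_rpow_mul_le`).

The mean value property is proved with the radial weight `(1 - |z|²)₊²`
(`integral_radialBump_smul_eq`): the derivative in `t` of `∫ (1 - |z|²)₊² f(x + tz) dz` vanishes
by integration by parts, because `(1 - |z|²)₊² z` is a multiple of the gradient of `(1 - |z|²)₊³`.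
-/

namespace HarmonicBall

open scoped Laplacian

/-! ### The mean value property -/

section MeanValue

variable {E : Type*} [NormedAddCommGroup E]

/-- The radial profile `(1 - |z|²)₊ᵏ`, supported in the closed unit ball. -/
noncomputable def radialBump (k : ℕ) (z : E) : ℝ := (max (1 - ‖z‖ ^ 2) 0) ^ k

lemma continuous_radialBump (k : ℕ) : Continuous (radialBump k : E → ℝ) := by
  unfold radialBump; fun_prop

lemma radialBump_nonneg (k : ℕ) (z : E) : 0 ≤ radialBump k z := by
  unfold radialBump; positivity

lemma radialBump_le_one (k : ℕ) (z : E) : radialBump k z ≤ 1 := by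
  unfold radialBump
  refine pow_le_one₀ (by positivity) (max_le ?_ zero_le_one)
  nlinarith [sq_nonneg ‖z‖]

lemma radialBump_eq_zero {k : ℕ} (hk : k ≠ 0) {z : E} (hz : 1 ≤ ‖z‖) : radialBump k z = 0 := by
  unfold radialBump
  rw [max_eq_right (by nlinarith), zero_pow hk]

lemma support_radialBump_subset {k : ℕ} (hk : k ≠ 0) :
    Function.support (radialBump k : E → ℝ) ⊆ ball 0 1 := by
  intro z hz
  rw [mem_ball_zero_iff]
  by_contra! h
  exact hz (radialBump_eq_zero hk h)

lemma tsupport_radialBump_subset {k : ℕ} (hk : k ≠ 0) :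
    tsupport (radialBump k : E → ℝ) ⊆ closedBall 0 1 :=
  closure_minimal ((support_radialBump_subset hk).trans ball_subset_closedBall)
    isClosed_closedBall

lemma hasDerivAt_max_zero_pow_three (x : ℝ) :
    HasDerivAt (fun y : ℝ => (max y 0) ^ 3) (3 * (max x 0) ^ 2) x := by
  rcases lt_trichotomy x 0 with h | h | h
  · rw [max_eq_right h.le]
    have : (fun y : ℝ => (max y 0) ^ 3) =ᶠ[nhds x] fun _ => 0 := by
      filter_upwards [gt_mem_nhds h] with y hy
      rw [max_eq_right hy.le]; norm_num
    simpa using (hasDerivAt_const x (0 : ℝ)).congr_of_eventuallyEq this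
  · subst h
    have h0 : (fun y : ℝ => (max y 0) ^ 3) =O[nhds 0] fun y => ‖y - 0‖ ^ 3 := by
      refine Asymptotics.IsBigO.of_bound 1 (Filter.Eventually.of_forall fun y => ?_)
      rw [sub_zero, one_mul, norm_pow, norm_pow, norm_norm]
      gcongr
      rw [Real.norm_eq_abs, Real.norm_eq_abs, abs_of_nonneg (le_max_right _ _)]
      exact max_le (le_abs_self y) (abs_nonneg y)
    have := h0.hasFDerivAt (𝕜 := ℝ) (n := 3) (by norm_num)
    simpa using this.hasDerivAt
  · rw [max_eq_left h.le]
    have : (fun y : ℝ => (max y 0) ^ 3) =ᶠ[nhds x] fun y => y ^ 3 := by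
      filter_upwards [lt_mem_nhds h] with y hy
      rw [max_eq_left hy.le]
    simpa using (hasDerivAt_pow 3 x).congr_of_eventuallyEq this

variable [InnerProductSpace ℝ E]

lemma hasFDerivAt_radialBump_three (z : E) :
    HasFDerivAt (radialBump 3) ((-6 * radialBump 2 z) • innerSL ℝ z) z := by
  have h1 : HasFDerivAt (fun y : E => 1 - ‖y‖ ^ 2) (-((2 : ℝ) • innerSL ℝ z)) z := by
    have := (hasStrictFDerivAt_norm_sq z).hasFDerivAt.const_sub 1
    simpa [two_smul] using this
  have h2 := (hasDerivAt_max_zero_pow_three (1 - ‖z‖ ^ 2)).comp_hasFDerivAt z h1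
  refine HasFDerivAt.congr_fderiv (f := radialBump 3) h2 ?_
  ext v
  simp only [radialBump, FunLike.coe_smul, Pi.smul_apply, smul_eq_mul, FunLike.coe_neg,
    Pi.neg_apply]
  ring

variable [FiniteDimensional ℝ E] [MeasurableSpace E] [BorelSpace E]
  (μ : Measure E) [μ.IsAddHaarMeasure]

lemma integrable_radialBump_smul {k : ℕ} (hk : k ≠ 0) {u : E → ℂ}
    (hu : ContinuousOn u (closedBall 0 1)) :
    Integrable (fun z => radialBump k z • u z) μ := by
  have h : IntegrableOn (fun z => radialBump k z • u z) (closedBall 0 1) μ :=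
    ((continuous_radialBump k).continuousOn.smul hu).integrableOn_compact
      (isCompact_closedBall 0 1)
  refine (integrableOn_iff_integrable_of_support_subset ?_).1 h
  exact (Function.support_smul_subset_left _ _).trans
    ((support_radialBump_subset hk).trans ball_subset_closedBall)

/-- The divergence theorem for the compactly supported field `(1 - |z|²)₊³ ∇f(x + tz)`: since
the gradient of `(1 - |z|²)₊³` is `-6 (1 - |z|²)₊² z`, harmonicity of `f` kills the integral of
the radial derivative of `f` against `(1 - |z|²)₊²`. -/
lemma integral_radialBump_fderiv_eq_zero {f : E → ℂ} {x : E} {R t : ℝ}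
    (hf : HarmonicOnNhd f (ball x R)) (ht : |t| < R) :
    ∫ z, radialBump 2 z • fderiv ℝ f (x + t • z) z ∂μ = 0 := by
  have hmem : ∀ z ∈ closedBall (0 : E) 1, x + t • z ∈ ball x R := by
    intro z hz
    rw [mem_closedBall_zero_iff] at hz
    rw [mem_ball, dist_self_add_left, norm_smul, Real.norm_eq_abs]
    nlinarith [abs_nonneg t]
  have hcd : ContDiffOn ℝ 1 (fderiv ℝ f) (ball x R) :=
    hf.contDiffOn.fderiv_of_isOpen isOpen_ball (by norm_num)
  have hline : Continuous fun z : E => x + t • z := by fun_prop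
  have hD : ∀ z ∈ closedBall (0 : E) 1, DifferentiableAt ℝ (fderiv ℝ f) (x + t • z) :=
    fun z hz => (hcd.contDiffAt (isOpen_ball.mem_nhds (hmem z hz))).differentiableAt (by norm_num)
  have hc1 : ContinuousOn (fun z : E => fderiv ℝ f (x + t • z)) (closedBall 0 1) :=
    hcd.continuousOn.comp hline.continuousOn hmem
  have hc2 : ContinuousOn (fun z : E => fderiv ℝ (fderiv ℝ f) (x + t • z)) (closedBall 0 1) :=
    (hcd.continuousOn_fderiv_of_isOpen isOpen_ball (by norm_num)).comp hline.continuousOn hmem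
  let b := stdOrthonormalBasis ℝ E
  have hv : ∀ i, ∀ z ∈ closedBall (0 : E) 1,
      HasFDerivAt (fun y : E => fderiv ℝ f (x + t • y) (b i))
        (t • (fderiv ℝ (fderiv ℝ f) (x + t • z)).flip (b i)) z := by
    intro i z hz
    have h1 : HasFDerivAt (fun y : E => x + t • y) (t • ContinuousLinearMap.id ℝ E) z :=
      ((hasFDerivAt_id z).const_smul t).const_add x
    have h2 := (hD z hz).hasFDerivAt.comp z h1
    have h3 := h2.clm_apply (hasFDerivAt_const (b i) z)
    refine h3.congr_fderiv ?_
    ext w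
    simp
  have hI1 : ∀ i, Integrable
      (fun z => radialBump 2 z • ((inner ℝ z (b i) : ℝ) • fderiv ℝ f (x + t • z) (b i))) μ := by
    intro i
    refine integrable_radialBump_smul μ two_ne_zero ?_
    exact ContinuousOn.smul
      (f := fun z : E => (inner ℝ z (b i) : ℝ)) (by fun_prop) (hc1.clm_apply continuousOn_const)
  have hI2 : ∀ i, Integrable (fun z => radialBump 3 z •
      (fderiv ℝ (fderiv ℝ f) (x + t • z) (b i) (b i))) μ := fun i =>
    integrable_radialBump_smul μ three_ne_zero
      ((hc2.clm_apply continuousOn_const).clm_apply continuousOn_const)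
  have hparts : ∀ i, (t : ℂ) * ∫ z, radialBump 3 z •
      (fderiv ℝ (fderiv ℝ f) (x + t • z) (b i) (b i)) ∂μ =
      6 * ∫ z, radialBump 2 z • ((inner ℝ z (b i) : ℝ) • fderiv ℝ f (x + t • z) (b i)) ∂μ := by
    intro i
    have key := integral_bilinear_hasFDerivAt_right_eq_neg_left_of_integrable (μ := μ)
      (f := (radialBump 3 : E → ℝ)) (f' := fun z => (-6 * radialBump 2 z) • innerSL ℝ z)
      (g := fun z => fderiv ℝ f (x + t • z) (b i))
      (g' := fun z => t • (fderiv ℝ (fderiv ℝ f) (x + t • z)).flip (b i))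
      (v := b i) (B := ContinuousLinearMap.lsmul ℝ ℝ) ?_ ?_ ?_
      (fun z _ => hasFDerivAt_radialBump_three z)
      (fun z hz => hv i z (tsupport_radialBump_subset three_ne_zero hz))
    · rw [← integral_const_mul, ← integral_const_mul]
      convert key using 1
      · refine integral_congr_ae (Filter.Eventually.of_forall fun z => ?_)
        simp
        ring
      · rw [← integral_neg]
        refine integral_congr_ae (Filter.Eventually.of_forall fun z => ?_)
        simp
        ring
    · convert (hI1 i).smul (-6 : ℝ) using 2 with z
      simp [mul_assoc]
    · convert (hI2 i).smul t using 2 with z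
      simp
      ring
    · exact integrable_radialBump_smul μ three_ne_zero (hc1.clm_apply continuousOn_const)
  have hsum := Finset.sum_congr rfl fun i (_ : i ∈ Finset.univ) => hparts i
  rw [← Finset.mul_sum, ← Finset.mul_sum, ← integral_finsetSum _ fun i _ => hI2 i,
    ← integral_finsetSum _ fun i _ => hI1 i] at hsum
  have hzero : ∫ z, ∑ i, radialBump 3 z •
      (fderiv ℝ (fderiv ℝ f) (x + t • z) (b i) (b i)) ∂μ = 0 := by
    refine integral_eq_zero_of_ae (Filter.Eventually.of_forall fun z => ?_)
    by_cases hz : z ∈ closedBall (0 : E) 1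
    · have h1 := (hf _ (hmem z hz)).2.self_of_nhds
      rw [laplacian_eq_iteratedFDeriv_orthonormalBasis f b] at h1
      simp only [iteratedFDeriv_two_apply] at h1
      simp only [Matrix.cons_val_zero, Matrix.cons_val_one] at h1
      simp only [← Finset.smul_sum]
      rw [h1]
      simp
    · simp at hz
      simp [radialBump_eq_zero three_ne_zero hz.le]
  rw [hzero, mul_zero] at hsum
  have hfin : (fun z => radialBump 2 z • fderiv ℝ f (x + t • z) z) = fun z =>
      ∑ i, radialBump 2 z • ((inner ℝ z (b i) : ℝ) • fderiv ℝ f (x + t • z) (b i)) := by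
    ext z
    rw [← Finset.smul_sum]
    congr 1
    have hz : fderiv ℝ f (x + t • z) z =
        fderiv ℝ f (x + t • z) (∑ i, (inner ℝ z (b i) : ℝ) • b i) := by
      congr 1
      simpa [b.repr_apply_apply, real_inner_comm] using (b.sum_repr z).symm
    rw [hz, map_sum]
    simp
  rw [hfin]
  simpa using hsum.symm

/-- The mean value property of harmonic functions, for the radial weight `(1 - |z|²)₊²`. -/
theorem integral_radialBump_smul_eq {f : E → ℂ} {x : E} {R t : ℝ}
    (hf : HarmonicOnNhd f (ball x R)) (ht0 : 0 ≤ t) (ht : t < R) :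
    ∫ z, radialBump 2 z • f (x + t • z) ∂μ = (∫ z : E, radialBump 2 z ∂μ) • f x := by
  have hmem : ∀ s : ℝ, |s| < R → ∀ z ∈ closedBall (0 : E) 1, x + s • z ∈ ball x R := by
    intro s hs z hz
    rw [mem_closedBall_zero_iff] at hz
    rw [mem_ball, dist_self_add_left, norm_smul, Real.norm_eq_abs]
    nlinarith [abs_nonneg s]
  have hcont : ContinuousOn (fderiv ℝ f) (ball x R) :=
    hf.contDiffOn.continuousOn_fderiv_of_isOpen isOpen_ball (by norm_num)
  have hint : ∀ s : ℝ, |s| < R → Integrable (fun z => radialBump 2 z • f (x + s • z)) μ :=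
    fun s hs => integrable_radialBump_smul μ two_ne_zero
      (hf.contDiffOn.continuousOn.comp (by fun_prop) (hmem s hs))
  have hderiv : ∀ s ∈ Set.Ioo (-R) R,
      HasDerivAt (fun s : ℝ => ∫ z, radialBump 2 z • f (x + s • z) ∂μ) 0 s := by
    intro s hs
    have hs' : |s| < R := abs_lt.2 hs
    obtain ⟨R', hR1, hR2⟩ := exists_between hs'
    have hsub : closedBall x R' ⊆ ball x R := closedBall_subset_ball hR2
    obtain ⟨M, hM⟩ := (isCompact_closedBall x R').exists_bound_of_continuousOn (hcont.mono hsub)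
    have hF'int : Integrable (fun z => radialBump 2 z • fderiv ℝ f (x + s • z) z) μ :=
      integrable_radialBump_smul μ two_ne_zero
        ((hcont.comp (by fun_prop) (hmem s hs')).clm_apply continuousOn_id)
    have hnhds : Set.Ioo (-R') R' ∈ nhds s := Ioo_mem_nhds (abs_lt.1 hR1).1 (abs_lt.1 hR1).2
    have key := hasDerivAt_integral_of_dominated_loc_of_deriv_le (μ := μ) (𝕜 := ℝ)
      (F := fun s z => radialBump 2 z • f (x + s • z))
      (F' := fun s z => radialBump 2 z • fderiv ℝ f (x + s • z) z)
      (x₀ := s) (s := Set.Ioo (-R') R')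
      (bound := fun z => radialBump 2 z * M) hnhds ?_ (hint s hs') hF'int.aestronglyMeasurable
      ?_ ?_ ?_
    · rw [integral_radialBump_fderiv_eq_zero μ hf hs'] at key
      exact key.2
    · filter_upwards [hnhds] with r hr
      exact (hint r ((abs_lt.2 hr).trans hR2)).aestronglyMeasurable
    · refine Filter.Eventually.of_forall fun z r hr => ?_
      rw [norm_smul, Real.norm_of_nonneg (radialBump_nonneg 2 z)]
      by_cases hz : ‖z‖ < 1
      · refine mul_le_mul_of_nonneg_left ?_ (radialBump_nonneg 2 z)
        have hin : x + r • z ∈ closedBall x R' := by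
          rw [mem_closedBall, dist_self_add_left, norm_smul, Real.norm_eq_abs]
          nlinarith [abs_nonneg r, abs_lt.2 hr]
        calc ‖fderiv ℝ f (x + r • z) z‖ ≤ ‖fderiv ℝ f (x + r • z)‖ * ‖z‖ :=
              ContinuousLinearMap.le_opNorm _ _
          _ ≤ ‖fderiv ℝ f (x + r • z)‖ * 1 := by gcongr
          _ ≤ M := by rw [mul_one]; exact hM _ hin
      · simp [radialBump_eq_zero two_ne_zero (not_lt.1 hz)]
    · have := integrable_radialBump_smul μ (k := 2) two_ne_zero (u := fun _ => (1 : ℂ))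
        continuousOn_const
      simpa using this.norm.mul_const M |>.congr (Filter.Eventually.of_forall fun z => by
        simp [abs_of_nonneg (radialBump_nonneg 2 z)])
    · refine Filter.Eventually.of_forall fun z r hr => ?_
      by_cases hz : ‖z‖ < 1
      · have hin : x + r • z ∈ ball x R :=
          hmem r ((abs_lt.2 hr).trans hR2) z (by simpa using hz.le)
        have h1 : HasFDerivAt f (fderiv ℝ f (x + r • z)) (x + r • z) :=
          ((hf _ hin).1.differentiableAt (by norm_num)).hasFDerivAt
        have h2 : HasDerivAt (fun r : ℝ => x + r • z) z r := by
          simpa using ((hasDerivAt_id r).smul_const z).const_add x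
        exact (h1.comp_hasDerivAt r h2).const_smul (radialBump 2 z)
      · have : ∀ r : ℝ, radialBump 2 z = 0 := fun _ =>
          radialBump_eq_zero two_ne_zero (not_lt.1 hz)
        simpa [this r] using hasDerivAt_const r (0 : ℂ)
  have hR : 0 < R := ht0.trans_lt ht
  have hconst := isOpen_Ioo.is_const_of_deriv_eq_zero (isPreconnected_Ioo (a := -R) (b := R))
    (fun s hs => (hderiv s hs).differentiableAt.differentiableWithinAt)
    (fun s hs => (hderiv s hs).deriv) (x := t) (y := 0) ⟨by linarith, ht⟩ ⟨by linarith, hR⟩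
  rw [hconst, ← integral_smul_const]
  simp

end MeanValue

/-! ### Harmonic kernels with a pole outside the ball -/

section Kernel

variable {E : Type*} [NormedAddCommGroup E] [InnerProductSpace ℝ E]

/-- The second derivative of `f` at `x` in the direction `v`, read off from the restriction of `f`
to the line `x + ℝv`. -/
lemma fderiv_fderiv_apply_self_eq {F : Type*} [NormedAddCommGroup F] [NormedSpace ℝ F]
    {f : E → F} {x v : E} {φ' : ℝ → F} {c : F}
    (hf : ContDiffAt ℝ 2 f x)
    (h1 : ∀ᶠ t : ℝ in nhds 0, HasDerivAt (fun s : ℝ => f (x + s • v)) (φ' t) t)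
    (h2 : HasDerivAt φ' c 0) : fderiv ℝ (fderiv ℝ f) x v v = c := by
  have hline : ∀ t : ℝ, HasDerivAt (fun s : ℝ => x + s • v) v t := fun t => by
    simpa using ((hasDerivAt_id t).smul_const v).const_add x
  have hx : x + (0 : ℝ) • v = x := by simp
  have hd : ∀ᶠ y in nhds x, DifferentiableAt ℝ f y := by
    filter_upwards [hf.eventually (by simp)] with y hy
    exact hy.differentiableAt (by norm_num)
  have htend : Filter.Tendsto (fun t : ℝ => x + t • v) (nhds 0) (nhds x) := by
    have := (hline 0).continuousAt.tendsto
    rwa [hx] at this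
  have heq : φ' =ᶠ[nhds 0] fun t => fderiv ℝ f (x + t • v) v := by
    filter_upwards [h1, htend.eventually hd] with t ht htd
    exact ht.unique (htd.hasFDerivAt.comp_hasDerivAt t (hline t))
  have h3 : HasFDerivAt (fderiv ℝ f) (fderiv ℝ (fderiv ℝ f) x) (x + (0 : ℝ) • v) := by
    rw [hx]
    exact ((hf.fderiv_right (m := 1) (by norm_num)).differentiableAt (by norm_num)).hasFDerivAt
  have h4 : HasDerivAt (fun t : ℝ => fderiv ℝ f (x + t • v)) (fderiv ℝ (fderiv ℝ f) x v) 0 :=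
    h3.comp_hasDerivAt (0 : ℝ) (hline 0)
  have h5 : HasDerivAt (fun t : ℝ => fderiv ℝ f (x + t • v) v) (fderiv ℝ (fderiv ℝ f) x v v) 0 := by
    simpa using h4.clm_apply (hasDerivAt_const (0 : ℝ) v)
  exact (h5.congr_of_eventuallyEq heq).unique h2

/-- The complex linear form `y ↦ ⟨e, y⟩ + i⟨e', y⟩`. Its powers are harmonic if `e`, `e'` are
orthonormal. -/
noncomputable def planarForm (e e' : E) (y : E) : ℂ :=
  (inner ℝ e y : ℝ) + (inner ℝ e' y : ℝ) * Complex.I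

/-- The Kelvin transform `|y|^(2 - n - 2(k+2)) (⟨e, y⟩ + i⟨e', y⟩)^(k+2)`, `y = x - b`, of a
power of `planarForm`, with pole at `b`. It has degree of homogeneity `-(n + k)` about `b`. The
exponent is written `k + 2` so that two derivatives leave a natural exponent; the real power is
taken of `|y|²`, which is smooth off the pole. -/
noncomputable def poleKernel (e e' b : E) (k : ℕ) (x : E) : ℂ :=
  ((‖x - b‖ ^ 2) ^ (-((Module.finrank ℝ E : ℝ) + 2 * k + 2) / 2) : ℝ) *
    planarForm e e' (x - b) ^ (k + 2)

lemma continuous_planarForm (e e' : E) : Continuous (planarForm e e') := by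
  unfold planarForm; fun_prop

lemma measurable_poleKernel [MeasurableSpace E] [BorelSpace E]
    (e e' b : E) (k : ℕ) : Measurable (poleKernel e e' b k) := by
  have h1 : Measurable fun x : E => planarForm e e' (x - b) :=
    ((continuous_planarForm e e').comp (continuous_id.sub continuous_const)).measurable
  have h2 : Measurable fun x : E => ‖x - b‖ ^ 2 :=
    (by fun_prop : Continuous fun x : E => ‖x - b‖ ^ 2).measurable
  exact (Complex.measurable_ofReal.comp (h2.pow_const _)).mul (h1.pow_const _)

lemma contDiffAt_poleKernel (e e' : E) {b x : E} (k : ℕ) (hx : x ≠ b) :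
    ContDiffAt ℝ 2 (poleKernel e e' b k) x := by
  have h0 : ‖x - b‖ ^ 2 ≠ 0 := by
    simpa [sub_eq_zero] using hx
  have h1 : ContDiffAt ℝ 2 (fun x : E => ‖x - b‖ ^ 2) x :=
    (contDiffAt_id.sub contDiffAt_const).norm_sq ℝ
  have h2 := h1.rpow_const_of_ne (p := -((Module.finrank ℝ E : ℝ) + 2 * k + 2) / 2) h0
  have h3 : ContDiffAt ℝ 2 (fun x : E => planarForm e e' (x - b)) x := by
    unfold planarForm
    have h4 : ∀ w : E, ContDiffAt ℝ 2 (fun x : E => ((inner ℝ w (x - b) : ℝ) : ℂ)) x := fun w =>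
      Complex.ofRealCLM.contDiff.contDiffAt.comp x
        (contDiffAt_const.inner ℝ (contDiffAt_id.sub contDiffAt_const))
    exact (h4 e).add ((h4 e').mul contDiffAt_const)
  exact (Complex.ofRealCLM.contDiff.contDiffAt.comp x h2).mul (h3.pow _)

variable [FiniteDimensional ℝ E]

/-- The Laplacian is computed as the sum of second derivatives along an orthonormal basis. Writing
`q = |y|²`, `l = planarForm e e' y` and `σ = -(n + 2k + 2) / 2`, the kernel is `q^σ l^(k+2)`, and
the sum is `2σ (2σ + n + 2k + 2) q^(σ-1) l^(k+2) = 0`. -/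
lemma laplacian_poleKernel {e e' : E} (he : ‖e‖ = 1) (he' : ‖e'‖ = 1)
    (hee' : inner ℝ e e' = (0 : ℝ))
    {b x : E} (k : ℕ) (hx : x ≠ b) : Δ (poleKernel e e' b k) x = 0 := by
  set σ : ℝ := -((Module.finrank ℝ E : ℝ) + 2 * k + 2) / 2 with hσ
  let w := stdOrthonormalBasis ℝ E
  set y := x - b with hy
  set q : ℝ := ‖y‖ ^ 2 with hq
  have hq0 : 0 < q := by
    have : y ≠ 0 := sub_ne_zero.2 hx
    positivity
  set l : ℂ := planarForm e e' y with hl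
  have hsecond : ∀ i, fderiv ℝ (fderiv ℝ (poleKernel e e' b k)) x (w i) (w i) =
      ((σ * (σ - 1) * q ^ (σ - 2) * (2 * inner ℝ y (w i)) ^ 2 + 2 * σ * q ^ (σ - 1) : ℝ) : ℂ) *
        l ^ (k + 2)
      + 2 * ((σ * q ^ (σ - 1) * (2 * inner ℝ y (w i)) : ℝ) : ℂ) *
        ((k + 2) * l ^ (k + 1) * planarForm e e' (w i))
      + ((q ^ σ : ℝ) : ℂ) * ((k + 2) * (k + 1) * l ^ k * planarForm e e' (w i) ^ 2) := by
    intro i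
    set c : ℝ := inner ℝ y (w i)
    set m : ℂ := planarForm e e' (w i) with hm
    have hQ : ∀ t : ℝ, ‖x + t • w i - b‖ ^ 2 = q + 2 * c * t + t ^ 2 := by
      intro t
      have : x + t • w i - b = y + t • w i := by rw [hy]; abel
      rw [this, norm_add_sq_real, inner_smul_right, norm_smul, w.norm_eq_one]
      simp [q, c]
      ring
    have hL : ∀ t : ℝ, planarForm e e' (x + t • w i - b) = l + t * m := by
      intro t
      have : x + t • w i - b = y + t • w i := by rw [hy]; abel
      rw [this]
      simp only [planarForm, hl, hm, inner_add_right, inner_smul_right]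
      push_cast
      ring
    have hdQ : ∀ t : ℝ, HasDerivAt (fun t : ℝ => q + 2 * c * t + t ^ 2) (2 * c + 2 * t) t := by
      intro t
      have := (((hasDerivAt_id t).const_mul (2 * c)).const_add q).add (hasDerivAt_pow 2 t)
      refine (this.congr_deriv (by simp)).congr_of_eventuallyEq (Filter.Eventually.of_forall ?_)
      intro s
      simp
    have hdL : ∀ t : ℝ, HasDerivAt (fun t : ℝ => l + (t : ℂ) * m) m t := by
      intro t
      simpa using ((hasDerivAt_id t).ofReal_comp.mul_const m).const_add l
    have hpos : ∀ᶠ t : ℝ in nhds 0, q + 2 * c * t + t ^ 2 ≠ 0 := by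
      have h := (hdQ 0).continuousAt.eventually_ne (y := 0) (by simpa using hq0.ne')
      exact h
    have hR : ∀ (τ t : ℝ), q + 2 * c * t + t ^ 2 ≠ 0 →
        HasDerivAt (fun t : ℝ => (((q + 2 * c * t + t ^ 2) ^ τ : ℝ) : ℂ))
          (((2 * c + 2 * t) * τ * (q + 2 * c * t + t ^ 2) ^ (τ - 1) : ℝ) : ℂ) t :=
      fun τ t ht => ((hdQ t).rpow_const (Or.inl ht)).ofReal_comp
    refine fderiv_fderiv_apply_self_eq
      (φ' := fun t : ℝ => (((2 * c + 2 * t) * σ * (q + 2 * c * t + t ^ 2) ^ (σ - 1) : ℝ) : ℂ) *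
        (l + t * m) ^ (k + 2) + (((q + 2 * c * t + t ^ 2) ^ σ : ℝ) : ℂ) *
        (((k + 2 : ℕ) : ℂ) * (l + t * m) ^ (k + 1) * m))
      (contDiffAt_poleKernel e e' k hx) ?_ ?_
    · filter_upwards [hpos] with t ht
      have h := (hR σ t ht).mul ((hdL t).pow (k + 2))
      have hfun : (fun s : ℝ => poleKernel e e' b k (x + s • w i)) = fun t : ℝ =>
          (((q + 2 * c * t + t ^ 2) ^ σ : ℝ) : ℂ) * (l + t * m) ^ (k + 2) := by
        ext s
        simp only [poleKernel, hQ, hL, hσ]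
      rw [hfun]
      exact h
    · have hne : q + 2 * c * 0 + (0 : ℝ) ^ 2 ≠ 0 := by simpa using hq0.ne'
      have hlin : HasDerivAt (fun t : ℝ => (((2 * c + 2 * t) * σ : ℝ) : ℂ))
          ((2 * σ : ℝ) : ℂ) 0 := by
        have := (((hasDerivAt_id (0 : ℝ)).const_mul 2).const_add (2 * c)).mul_const σ
        simpa using this.ofReal_comp
      have h := ((hlin.mul (hR (σ - 1) 0 hne)).mul ((hdL 0).pow (k + 2))).add
        ((hR σ 0 hne).mul ((((hdL 0).pow (k + 1)).const_mul ((k + 2 : ℕ) : ℂ)).mul_const m))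
      convert h using 1
      · ext t
        simp
      · have : σ - 1 - 1 = σ - 2 := by ring
        simp [this]
        ring
  rw [laplacian_eq_iteratedFDeriv_orthonormalBasis _ w]
  simp only [iteratedFDeriv_two_apply, Matrix.cons_val_zero, Matrix.cons_val_one, hsecond]
  have s1 : ∑ i, (inner ℝ y (w i) : ℝ) ^ 2 = q := by
    have := w.sum_inner_mul_inner y y
    rw [real_inner_self_eq_norm_sq] at this
    rw [hq, ← this]
    exact Finset.sum_congr rfl fun i _ => by rw [sq, real_inner_comm y (w i)]
  have hin : ∀ u v : E, ∑ i, (inner ℝ u (w i) : ℂ) * (inner ℝ v (w i) : ℂ) = (inner ℝ u v : ℝ) := by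
    intro u v
    rw [← w.sum_inner_mul_inner u v]
    push_cast
    exact Finset.sum_congr rfl fun i _ => by rw [real_inner_comm v (w i)]
  have s2 : ∑ i, (inner ℝ y (w i) : ℂ) * planarForm e e' (w i) = l := by
    simp only [planarForm, mul_add, Finset.sum_add_distrib, ← mul_assoc, ← Finset.sum_mul, hin, hl]
    rw [real_inner_comm e y, real_inner_comm e' y]
  -- the form is null: `|e|² - |e'|² + 2i⟨e, e'⟩ = 0`
  have s3 : ∑ i, planarForm e e' (w i) ^ 2 = 0 := by
    have : ∀ i, planarForm e e' (w i) ^ 2 = (inner ℝ e (w i) : ℂ) * (inner ℝ e (w i) : ℂ)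
        - (inner ℝ e' (w i) : ℂ) * (inner ℝ e' (w i) : ℂ)
        + 2 * Complex.I * ((inner ℝ e (w i) : ℂ) * (inner ℝ e' (w i) : ℂ)) := by
      intro i
      simp only [planarForm]
      ring_nf
      rw [Complex.I_sq]
      ring
    simp only [this, Finset.sum_add_distrib, Finset.sum_sub_distrib, ← Finset.mul_sum, hin, hee',
      real_inner_self_eq_norm_sq, he, he']
    simp
  have hqσ : q ^ (σ - 1) = q ^ (σ - 2) * q := by
    rw [← Real.rpow_add_one hq0.ne']
    congr 1; ring
  have t1 : ∑ i, ((σ * (σ - 1) * q ^ (σ - 2) * (2 * inner ℝ y (w i)) ^ 2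
      + 2 * σ * q ^ (σ - 1) : ℝ) : ℂ) = ((4 * σ * (σ - 1) * q ^ (σ - 1)
      + 2 * σ * q ^ (σ - 1) * Module.finrank ℝ E : ℝ) : ℂ) := by
    rw [← Complex.ofReal_sum]
    congr 1
    simp only [mul_pow, Finset.sum_add_distrib, ← Finset.mul_sum, s1]
    simp [hqσ]
    ring
  have t2 : ∀ i, 2 * ((σ * q ^ (σ - 1) * (2 * inner ℝ y (w i)) : ℝ) : ℂ) *
        ((k + 2) * l ^ (k + 1) * planarForm e e' (w i)) =
      (4 * ((σ * q ^ (σ - 1) : ℝ) : ℂ) * (k + 2) * l ^ (k + 1)) *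
        ((inner ℝ y (w i) : ℂ) * planarForm e e' (w i)) := by
    intro i
    push_cast
    ring
  rw [Finset.sum_add_distrib, Finset.sum_add_distrib, ← Finset.sum_mul, t1]
  simp only [t2, ← Finset.mul_sum, s2, s3]
  have hσ' : (Module.finrank ℝ E : ℂ) = -2 * σ - 2 * k - 2 := by
    rw [hσ]; push_cast; ring
  push_cast
  rw [hσ']
  ring

theorem harmonicAt_poleKernel {e e' : E} (he : ‖e‖ = 1) (he' : ‖e'‖ = 1)
    (hee' : inner ℝ e e' = (0 : ℝ)) {b x : E} (k : ℕ) (hx : x ≠ b) :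
    HarmonicAt (poleKernel e e' b k) x := by
  refine ⟨contDiffAt_poleKernel e e' k hx, ?_⟩
  filter_upwards [isOpen_ne.mem_nhds hx] with y hy
  exact laplacian_poleKernel he he' hee' k hy

end Kernel

/-! ### Weighted volumes near the boundary of the ball -/

section WeightedVolume

lemma lintegral_Ioc_zero_rpow {ρ s : ℝ} (hρ : -1 < ρ) (hs : 0 ≤ s) :
    ∫⁻ u in Set.Ioc 0 s, ENNReal.ofReal (u ^ ρ) = ENNReal.ofReal (s ^ (ρ + 1) / (ρ + 1)) := by
  have hint : IntegrableOn (fun u : ℝ => u ^ ρ) (Set.Ioc 0 s) :=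
    (intervalIntegrable_iff_integrableOn_Ioc_of_le hs).1
      (intervalIntegral.intervalIntegrable_rpow' hρ)
  rw [← ofReal_integral_eq_lintegral_ofReal hint, ← intervalIntegral.integral_of_le hs,
    integral_rpow (Or.inl hρ), Real.zero_rpow (by linarith), sub_zero]
  filter_upwards [ae_restrict_mem measurableSet_Ioc] with u hu
  exact Real.rpow_nonneg hu.1.le _

/-- The integral of the weight `(1 - |x|)^ρ` over the part of the radial segment
`{ty : 1 ≤ t < 1 + s}` inside `𝔹`, with `r = |y|`. With `m` the smaller of `1 + s` and `1 / r`, the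
weight at `ty` is at most `((m - t) / 4)^ρ`. -/
lemma lintegral_dilation_weight_le {ρ s r : ℝ} (hρ : -1 < ρ) (hρ0 : ρ ≤ 0) (hs : 0 ≤ s)
    (hr : 1 / 4 ≤ r) :
    ∫⁻ t in Set.Ico 1 (1 + s), (if t * r < 1 then ENNReal.ofReal ((1 - t * r) ^ ρ) else 0) ≤
      ENNReal.ofReal (4 ^ (-ρ)) * ENNReal.ofReal (s ^ (ρ + 1) / (ρ + 1)) := by
  have hr0 : 0 < r := by linarith
  set m : ℝ := min (1 + s) (1 / r) with hm
  let F : ℝ → ℝ≥0∞ := (Set.Ioc 0 s).indicator fun u => ENNReal.ofReal (4 ^ (-ρ)) *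
    ENNReal.ofReal (u ^ ρ)
  rw [← lintegral_indicator measurableSet_Ico]
  calc ∫⁻ t, (Set.Ico 1 (1 + s)).indicator
        (fun t => if t * r < 1 then ENNReal.ofReal ((1 - t * r) ^ ρ) else 0) t
      ≤ ∫⁻ t, F (m - t) := by
        refine lintegral_mono fun t => ?_
        by_cases ht : t ∈ Set.Ico 1 (1 + s)
        · rw [Set.indicator_of_mem ht]
          split_ifs with htr
          · have h1 : t < 1 / r := by rwa [lt_div_iff₀ hr0]
            have h2 : t < m := lt_min ht.2 h1
            have hmem : m - t ∈ Set.Ioc 0 s :=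
              ⟨by linarith, by linarith [min_le_left (1 + s) (1 / r), ht.1]⟩
            simp only [F]
            rw [Set.indicator_of_mem hmem, ← ENNReal.ofReal_mul (by positivity)]
            refine ENNReal.ofReal_le_ofReal ?_
            have h3 : (m - t) / 4 ≤ 1 - t * r := by
              have h4 : m * r ≤ 1 := by
                calc m * r ≤ 1 / r * r := by gcongr; exact min_le_right _ _
                  _ = 1 := by field_simp
              nlinarith [hmem.1]
            calc (1 - t * r) ^ ρ ≤ ((m - t) / 4) ^ ρ :=
                  Real.rpow_le_rpow_of_nonpos (by linarith [hmem.1]) h3 hρ0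
              _ = 4 ^ (-ρ) * (m - t) ^ ρ := by
                  rw [Real.div_rpow hmem.1.le (by norm_num), Real.rpow_neg (by norm_num)]
                  ring
          · exact zero_le
        · rw [Set.indicator_of_notMem ht]
          exact zero_le
    _ = ∫⁻ u, F u := lintegral_sub_left_eq_self F m
    _ = ENNReal.ofReal (4 ^ (-ρ)) * ENNReal.ofReal (s ^ (ρ + 1) / (ρ + 1)) := by
        simp only [F]
        rw [lintegral_indicator measurableSet_Ioc, lintegral_const_mul _ (by fun_prop),
          lintegral_Ioc_zero_rpow hρ hs]

variable {E : Type*} [NormedAddCommGroup E] [InnerProductSpace ℝ E] [FiniteDimensional ℝ E]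
  [MeasurableSpace E] [BorelSpace E] (μ : Measure E) [μ.IsAddHaarMeasure]

lemma lintegral_eq_mul_lintegral_comp_smul {t : ℝ} (ht : 0 < t) {G : E → ℝ≥0∞}
    (hG : Measurable G) :
    ∫⁻ x, G x ∂μ = ENNReal.ofReal (t ^ Module.finrank ℝ E) * ∫⁻ y, G (t • y) ∂μ := by
  have h : ∫⁻ y, G (t • y) ∂μ = ∫⁻ x, G x ∂(Measure.map (t • ·) μ) :=
    (lintegral_map hG (measurable_const_smul t)).symm
  rw [h, Measure.map_addHaar_smul μ ht.ne', lintegral_smul_measure, smul_eq_mul, ← mul_assoc,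
    ← ENNReal.ofReal_mul (by positivity), abs_of_pos (by positivity),
    mul_inv_cancel₀ (by positivity), ENNReal.ofReal_one, one_mul]

/-- A bound for the mass of a singular radial weight on `S`, obtained by averaging over the
dilates `t⁻¹ S`, `1 ≤ t < 1 + s`: this replaces the weight at a point by its mean over a radial
segment of length comparable to `s`, which is of size `s ^ ρ`. -/
lemma setLIntegral_weight_le_of_dilates {ρ s : ℝ} (hρ : -1 < ρ) (hρ0 : ρ ≤ 0) (hs : 0 < s)
    (hs1 : s ≤ 1) {S S' : Set E} (hS : MeasurableSet S) (hS' : MeasurableSet S')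
    (hSn : ∀ x ∈ S, 1 / 2 ≤ ‖x‖ ∧ ‖x‖ < 1)
    (hSS' : ∀ t ∈ Set.Ico 1 (1 + s), ∀ y : E, t • y ∈ S → y ∈ S') :
    ∫⁻ x in S, ENNReal.ofReal ((1 - ‖x‖) ^ ρ) ∂μ ≤
      ENNReal.ofReal (2 ^ Module.finrank ℝ E * 4 ^ (-ρ) / (ρ + 1)) * ENNReal.ofReal (s ^ ρ) *
        μ S' := by
  have hρ1 : 0 < ρ + 1 := by linarith
  set d := Module.finrank ℝ E
  let G : E → ℝ≥0∞ := S.indicator fun x => ENNReal.ofReal ((1 - ‖x‖) ^ ρ)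
  have hG : Measurable G := Measurable.indicator (by fun_prop) hS
  let T : Set E := S' ∩ {y | 1 / 4 ≤ ‖y‖}
  have hT : MeasurableSet T := hS'.inter (measurableSet_le measurable_const measurable_norm)
  let K : ℝ → E → ℝ≥0∞ := fun t y =>
    if t * ‖y‖ < 1 then ENNReal.ofReal ((1 - t * ‖y‖) ^ ρ) else 0
  have hK : Measurable (Function.uncurry K) := by
    refine Measurable.ite (measurableSet_lt (by fun_prop) measurable_const) (by fun_prop)
      measurable_const
  -- the substitution `x = ty`; points of `t⁻¹ S` have norm at least `1 / 4` because `t < 2`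
  have hslice : ∀ t ∈ Set.Ico 1 (1 + s),
      ∫⁻ x, G x ∂μ ≤ ENNReal.ofReal (2 ^ d) * ∫⁻ y in T, K t y ∂μ := by
    intro t ht
    have ht0 : 0 < t := by linarith [ht.1]
    rw [lintegral_eq_mul_lintegral_comp_smul μ ht0 hG, ← lintegral_indicator hT]
    gcongr with y
    · linarith [ht.2]
    · by_cases hy : t • y ∈ S
      · have hn : ‖t • y‖ = t * ‖y‖ := by rw [norm_smul, Real.norm_of_nonneg ht0.le]
        have h1 := hSn _ hy
        rw [hn] at h1
        have hyT : y ∈ T := by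
          refine ⟨hSS' t ht y hy, ?_⟩
          have : t * ‖y‖ ≤ 2 * ‖y‖ := by
            gcongr
            linarith [ht.2]
          simp only [Set.mem_ofPred_eq]
          linarith
        simp only [G, K]
        rw [Set.indicator_of_mem hy, Set.indicator_of_mem hyT, if_pos h1.2, hn]
      · simp only [G]
        rw [Set.indicator_of_notMem hy]
        exact zero_le
  have hmain : ENNReal.ofReal s * ∫⁻ x, G x ∂μ ≤ ENNReal.ofReal (2 ^ d) *
      ((ENNReal.ofReal (4 ^ (-ρ)) * ENNReal.ofReal (s ^ (ρ + 1) / (ρ + 1))) * μ S') := by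
    calc ENNReal.ofReal s * ∫⁻ x, G x ∂μ = ∫⁻ _ in Set.Ico (1 : ℝ) (1 + s), ∫⁻ x, G x ∂μ := by
          rw [setLIntegral_const, Real.volume_Ico, add_sub_cancel_left, mul_comm]
      _ ≤ ∫⁻ t in Set.Ico (1 : ℝ) (1 + s), ENNReal.ofReal (2 ^ d) * ∫⁻ y in T, K t y ∂μ :=
          setLIntegral_mono' measurableSet_Ico hslice
      _ = ENNReal.ofReal (2 ^ d) * ∫⁻ y in T, (∫⁻ t in Set.Ico (1 : ℝ) (1 + s), K t y) ∂μ := by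
          rw [lintegral_const_mul' _ _ ENNReal.ofReal_ne_top,
            lintegral_lintegral_swap hK.aemeasurable]
      _ ≤ ENNReal.ofReal (2 ^ d) * ∫⁻ y in T,
            (ENNReal.ofReal (4 ^ (-ρ)) * ENNReal.ofReal (s ^ (ρ + 1) / (ρ + 1))) ∂μ := by
          gcongr 1
          exact setLIntegral_mono' hT fun y hy =>
            lintegral_dilation_weight_le hρ hρ0 hs.le hy.2
      _ ≤ _ := by
          rw [setLIntegral_const]
          gcongr
          exact Set.inter_subset_left
  rw [← lintegral_indicator hS]
  have hs' : ENNReal.ofReal s ≠ 0 := by simpa using hs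
  have hfac : ENNReal.ofReal s * (ENNReal.ofReal (2 ^ d * 4 ^ (-ρ) / (ρ + 1)) *
      ENNReal.ofReal (s ^ ρ) * μ S') = ENNReal.ofReal (2 ^ d) *
      ((ENNReal.ofReal (4 ^ (-ρ)) * ENNReal.ofReal (s ^ (ρ + 1) / (ρ + 1))) * μ S') := by
    simp only [← mul_assoc]
    congr 1
    rw [← ENNReal.ofReal_mul hs.le, ← ENNReal.ofReal_mul (by positivity),
      ← ENNReal.ofReal_mul (by positivity), ← ENNReal.ofReal_mul (by positivity),
      Real.rpow_add_one hs.ne']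
    congr 1
    ring
  exact (ENNReal.mul_le_mul_iff_right hs' ENNReal.ofReal_ne_top).1 (hmain.trans hfac.ge)

lemma lintegral_ball_weight_lt_top {ρ : ℝ} (hρ : -1 < ρ) :
    ∫⁻ x in ball (0 : E) 1, ENNReal.ofReal ((1 - ‖x‖) ^ ρ) ∂μ < ∞ := by
  rcases le_total 0 ρ with h0 | h0
  · calc ∫⁻ x in ball (0 : E) 1, ENNReal.ofReal ((1 - ‖x‖) ^ ρ) ∂μ
        ≤ ∫⁻ _ in ball (0 : E) 1, 1 ∂μ := by
          refine setLIntegral_mono' measurableSet_ball fun x hx => ?_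
          rw [mem_ball_zero_iff] at hx
          rw [← ENNReal.ofReal_one]
          exact ENNReal.ofReal_le_ofReal
            (Real.rpow_le_one (by linarith) (by linarith [norm_nonneg x]) h0)
      _ < ∞ := by simpa using measure_ball_lt_top
  · let S : Set E := ball 0 1 ∩ {x | 1 / 2 ≤ ‖x‖}
    have hS : MeasurableSet S :=
      measurableSet_ball.inter (measurableSet_le measurable_const measurable_norm)
    have h1 := setLIntegral_weight_le_of_dilates μ hρ h0 one_pos le_rfl hS
      (measurableSet_ball (x := (0 : E)) (ε := 1)) (fun x hx => ⟨hx.2, by simpa using hx.1⟩)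
      (fun t ht y hy => by
        have h2 : ‖t • y‖ < 1 := by simpa using hy.1
        rw [norm_smul, Real.norm_of_nonneg (by linarith [ht.1])] at h2
        rw [mem_ball_zero_iff]
        nlinarith [ht.1, norm_nonneg y])
    have h2 : ∫⁻ x in ball (0 : E) (1 / 2), ENNReal.ofReal ((1 - ‖x‖) ^ ρ) ∂μ ≤
        ∫⁻ _ in ball (0 : E) (1 / 2), ENNReal.ofReal ((1 / 2) ^ ρ) ∂μ := by
      refine setLIntegral_mono' measurableSet_ball fun x hx => ?_
      rw [mem_ball_zero_iff] at hx
      exact ENNReal.ofReal_le_ofReal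
        (Real.rpow_le_rpow_of_nonpos (by norm_num) (by linarith) h0)
    have hsub : ball (0 : E) 1 ⊆ S ∪ ball 0 (1 / 2) := by
      intro x hx
      rcases le_or_gt (1 / 2) ‖x‖ with h | h
      · exact Or.inl ⟨hx, h⟩
      · exact Or.inr (by simpa using h)
    refine (lintegral_mono_set hsub).trans_lt ((lintegral_union_le _ _ _).trans_lt ?_)
    refine ENNReal.add_lt_top.2 ⟨h1.trans_lt ?_, h2.trans_lt ?_⟩
    · exact ENNReal.mul_lt_top (ENNReal.mul_lt_top ENNReal.ofReal_lt_top ENNReal.ofReal_lt_top)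
        measure_ball_lt_top
    · rw [setLIntegral_const]
      exact ENNReal.mul_lt_top ENNReal.ofReal_lt_top measure_ball_lt_top

/-- The weighted volume of `𝔹 ∩ B(b, s)`, for a centre `b` outside `𝔹`, is `O(s ^ (n + ρ))`. -/
lemma exists_lintegral_inter_ball_weight_le {ρ : ℝ} (hρ : -1 < ρ)
    (hE : 0 < Module.finrank ℝ E) :
    ∃ C : ℝ≥0, ∀ b : E, 1 ≤ ‖b‖ → ∀ s : ℝ, 0 < s →
      ∫⁻ x in ball 0 1 ∩ ball b s, ENNReal.ofReal ((1 - ‖x‖) ^ ρ) ∂μ ≤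
        C * ENNReal.ofReal (s ^ (Module.finrank ℝ E + ρ)) := by
  set d := Module.finrank ℝ E
  have hd : (1 : ℝ) ≤ d := by exact_mod_cast hE
  have hdist : ∀ (b : E), 1 ≤ ‖b‖ → ∀ (s : ℝ), ∀ x ∈ ball (0 : E) 1 ∩ ball b s,
      0 < 1 - ‖x‖ ∧ 1 - ‖x‖ ≤ s := by
    intro b hb s x hx
    have h1 : ‖x‖ < 1 := by simpa using hx.1
    have h2 : ‖b - x‖ < s := by simpa [dist_eq_norm, norm_sub_rev] using hx.2
    have h3 := norm_sub_norm_le b x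
    exact ⟨by linarith, by linarith⟩
  have hvol : ∀ (b : E) (s : ℝ), 0 < s →
      μ (ball b s) = ENNReal.ofReal (s ^ (d : ℝ)) * μ (ball 0 1) := fun b s hs => by
    rw [Measure.addHaar_ball_of_pos μ b hs, Real.rpow_natCast]
  have hV : μ (ball (0 : E) 1) ≠ ∞ := measure_ball_lt_top.ne
  -- for `ρ ≥ 0` the weight is at most `s ^ ρ` on the intersection, as `1 - |x| ≤ |x - b|`
  rcases le_total 0 ρ with h0 | h0
  · refine ⟨(μ (ball (0 : E) 1)).toNNReal, fun b hb s hs => ?_⟩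
    rw [ENNReal.coe_toNNReal hV]
    calc ∫⁻ x in ball 0 1 ∩ ball b s, ENNReal.ofReal ((1 - ‖x‖) ^ ρ) ∂μ
        ≤ ∫⁻ _ in ball 0 1 ∩ ball b s, ENNReal.ofReal (s ^ ρ) ∂μ := by
          refine setLIntegral_mono' (measurableSet_ball.inter measurableSet_ball) fun x hx => ?_
          have := hdist b hb s x hx
          exact ENNReal.ofReal_le_ofReal (Real.rpow_le_rpow this.1.le this.2 h0)
      _ ≤ ENNReal.ofReal (s ^ ρ) * μ (ball b s) := by
          rw [setLIntegral_const]
          gcongr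
          exact Set.inter_subset_right
      _ = _ := by
          rw [hvol b s hs, Real.rpow_add hs, ENNReal.ofReal_mul (by positivity)]
          ring
  · set T := ∫⁻ x in ball (0 : E) 1, ENNReal.ofReal ((1 - ‖x‖) ^ ρ) ∂μ with hTdef
    have hT : T ≠ ∞ := (lintegral_ball_weight_lt_top μ hρ).ne
    set A := ENNReal.ofReal (2 ^ d * 4 ^ (-ρ) / (ρ + 1)) * ENNReal.ofReal (2 ^ (d : ℝ)) *
      μ (ball (0 : E) 1) with hAdef
    have hA : A ≠ ∞ :=
      ENNReal.mul_ne_top (ENNReal.mul_ne_top ENNReal.ofReal_ne_top ENNReal.ofReal_ne_top) hV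
    refine ⟨(A + T * ENNReal.ofReal (2 ^ (d + ρ))).toNNReal, fun b hb s hs => ?_⟩
    rw [ENNReal.coe_toNNReal (ENNReal.add_ne_top.2
      ⟨hA, ENNReal.mul_ne_top hT ENNReal.ofReal_ne_top⟩), add_mul]
    -- for `s > 1 / 2` the total mass of the weight suffices, since `(2s) ^ (n + ρ) ≥ 1`
    rcases le_or_gt s (1 / 2) with hs2 | hs2
    · refine le_trans ?_ le_self_add
      have h1 := setLIntegral_weight_le_of_dilates μ hρ h0 hs (by linarith)
        ((measurableSet_ball (x := (0 : E)) (ε := 1)).inter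
          (measurableSet_ball (x := b) (ε := s)))
        (measurableSet_ball (x := b) (ε := 2 * s))
        (fun x hx => ⟨by linarith [(hdist b hb s x hx).2], by simpa using hx.1⟩)
        (fun t ht y hy => by
          have h2 : ‖t • y‖ < 1 := by simpa using hy.1
          have h3 : dist (t • y) b < s := hy.2
          have h4 : dist y (t • y) ≤ s := by
            have h5 : y - t • y = -((t - 1) • y) := by rw [sub_smul, one_smul]; abel
            rw [norm_smul, Real.norm_of_nonneg (by linarith [ht.1])] at h2
            rw [dist_eq_norm, h5, norm_neg, norm_smul,
              Real.norm_of_nonneg (by linarith [ht.1])]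
            have h6 : ‖y‖ ≤ 1 := by nlinarith [ht.1, norm_nonneg y]
            nlinarith [ht.1, ht.2, norm_nonneg y]
          rw [mem_ball]
          linarith [dist_triangle y (t • y) b])
      refine h1.trans_eq ?_
      rw [hvol b (2 * s) (by linarith), hAdef, Real.mul_rpow (by norm_num) hs.le,
        Real.rpow_add hs, ENNReal.ofReal_mul (by positivity), ENNReal.ofReal_mul (by positivity)]
      ring
    · refine le_trans ?_ le_add_self
      calc ∫⁻ x in ball 0 1 ∩ ball b s, ENNReal.ofReal ((1 - ‖x‖) ^ ρ) ∂μ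
          ≤ T * 1 := by
            rw [mul_one]
            exact lintegral_mono_set Set.inter_subset_left
        _ ≤ T * ENNReal.ofReal (2 ^ (d + ρ) * s ^ (d + ρ)) := by
            gcongr
            rw [← ENNReal.ofReal_one]
            refine ENNReal.ofReal_le_ofReal ?_
            rw [← Real.mul_rpow (by norm_num) hs.le]
            exact Real.one_le_rpow (by linarith) (by linarith)
        _ = _ := by
            rw [ENNReal.ofReal_mul (by positivity), mul_assoc]

lemma lintegral_Ioi_rpow {a c : ℝ} (ha : a < -1) (hc : 0 < c) :
    ∫⁻ u in Set.Ioi c, ENNReal.ofReal (u ^ a) = ENNReal.ofReal (c ^ (a + 1) / (-(a + 1))) := by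
  rw [← ofReal_integral_eq_lintegral_ofReal (integrableOn_Ioi_rpow_of_lt ha hc),
    integral_Ioi_rpow_of_lt ha hc, div_neg, neg_div]
  filter_upwards [ae_restrict_mem measurableSet_Ioi] with u hu
  exact Real.rpow_nonneg (hc.trans hu).le _

/-- The integral of the power `|x - b|^(-M)` against the weight, for a pole `b` at distance `δ`
from `𝔹`. By the layer cake formula it is an integral over the radii `s > δ` of the weighted
volumes of `𝔹 ∩ B(b, s)`. -/
lemma exists_lintegral_pole_weight_le {ρ M : ℝ} (hρ : -1 < ρ)
    (hE : 0 < Module.finrank ℝ E) (hM : Module.finrank ℝ E + ρ < M) :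
    ∃ C : ℝ≥0, ∀ δ : ℝ, 0 < δ → ∀ b : E, ‖b‖ = 1 + δ →
      ∫⁻ x in ball 0 1, ENNReal.ofReal (‖x - b‖ ^ (-M)) * ENNReal.ofReal ((1 - ‖x‖) ^ ρ) ∂μ ≤
        C * ENNReal.ofReal (δ ^ (Module.finrank ℝ E + ρ - M)) := by
  obtain ⟨C, hC⟩ := exists_lintegral_inter_ball_weight_le μ hρ hE
  set d := Module.finrank ℝ E
  have hd : (1 : ℝ) ≤ d := by exact_mod_cast hE
  have hM0 : 0 < M := by linarith
  refine ⟨(M * (M - d - ρ)⁻¹).toNNReal * C, fun δ hδ b hb => ?_⟩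
  have hfar : ∀ x ∈ ball (0 : E) 1, δ < ‖x - b‖ := by
    intro x hx
    rw [mem_ball_zero_iff] at hx
    have h := norm_sub_norm_le b x
    rw [norm_sub_rev]
    linarith
  have hmeas : Measurable (Function.uncurry fun (x : E) (s : ℝ) =>
      (if ‖x - b‖ < s then ENNReal.ofReal (s ^ (-M - 1)) * ENNReal.ofReal ((1 - ‖x‖) ^ ρ)
        else 0)) := by
    refine Measurable.ite (measurableSet_lt (by fun_prop) (by fun_prop)) (by fun_prop)
      measurable_const
  have hpt : ∀ x ∈ ball (0 : E) 1,
      ENNReal.ofReal (‖x - b‖ ^ (-M)) * ENNReal.ofReal ((1 - ‖x‖) ^ ρ) =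
        ENNReal.ofReal M * ∫⁻ s in Set.Ioi δ, (if ‖x - b‖ < s then
          ENNReal.ofReal (s ^ (-M - 1)) * ENNReal.ofReal ((1 - ‖x‖) ^ ρ) else 0) := by
    intro x hx
    have hx' := hfar x hx
    have h1 : ∀ s : ℝ, (if ‖x - b‖ < s then
          ENNReal.ofReal (s ^ (-M - 1)) * ENNReal.ofReal ((1 - ‖x‖) ^ ρ) else 0) =
        (Set.Ioi ‖x - b‖).indicator (fun s =>
          ENNReal.ofReal (s ^ (-M - 1)) * ENNReal.ofReal ((1 - ‖x‖) ^ ρ)) s := by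
      intro s
      simp [Set.indicator_apply]
    simp only [h1]
    rw [setLIntegral_indicator measurableSet_Ioi,
      Set.inter_eq_left.2 (Set.Ioi_subset_Ioi hx'.le), lintegral_mul_const _ (by fun_prop),
      lintegral_Ioi_rpow (by linarith) (hδ.trans hx'), ← mul_assoc,
      ← ENNReal.ofReal_mul hM0.le]
    congr 2
    rw [sub_add_cancel, neg_neg]
    field_simp
  have hswap : ∀ s ∈ Set.Ioi δ, ∫⁻ x in ball (0 : E) 1, (if ‖x - b‖ < s then
        ENNReal.ofReal (s ^ (-M - 1)) * ENNReal.ofReal ((1 - ‖x‖) ^ ρ) else 0) ∂μ ≤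
      C * ENNReal.ofReal (s ^ (d + ρ - M - 1)) := by
    intro s hs
    have hs0 : 0 < s := hδ.trans hs
    have h1 : ∀ x : E, (if ‖x - b‖ < s then
          ENNReal.ofReal (s ^ (-M - 1)) * ENNReal.ofReal ((1 - ‖x‖) ^ ρ) else 0) =
        (ball b s).indicator (fun x =>
          ENNReal.ofReal (s ^ (-M - 1)) * ENNReal.ofReal ((1 - ‖x‖) ^ ρ)) x := by
      intro x
      by_cases hx : ‖x - b‖ < s
      · rw [if_pos hx, Set.indicator_of_mem (by rwa [mem_ball, dist_eq_norm])]
      · rw [if_neg hx, Set.indicator_of_notMem (by rwa [mem_ball, dist_eq_norm])]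
    rw [lintegral_congr h1]
    rw [setLIntegral_indicator measurableSet_ball, lintegral_const_mul _ (by fun_prop),
      Set.inter_comm]
    calc _ ≤ ENNReal.ofReal (s ^ (-M - 1)) * (C * ENNReal.ofReal (s ^ (d + ρ))) := by
          gcongr
          exact hC b (by linarith) s hs0
      _ = C * ENNReal.ofReal (s ^ (d + ρ - M - 1)) := by
          rw [mul_left_comm, ← ENNReal.ofReal_mul (by positivity), ← Real.rpow_add hs0]
          congr 3
          ring
  calc ∫⁻ x in ball 0 1, ENNReal.ofReal (‖x - b‖ ^ (-M)) * ENNReal.ofReal ((1 - ‖x‖) ^ ρ) ∂μ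
      = ENNReal.ofReal M * ∫⁻ s in Set.Ioi δ, ∫⁻ x in ball (0 : E) 1, (if ‖x - b‖ < s then
          ENNReal.ofReal (s ^ (-M - 1)) * ENNReal.ofReal ((1 - ‖x‖) ^ ρ) else 0) ∂μ := by
        rw [setLIntegral_congr_fun measurableSet_ball hpt,
          lintegral_const_mul' _ _ ENNReal.ofReal_ne_top,
          lintegral_lintegral_swap hmeas.aemeasurable]
    _ ≤ ENNReal.ofReal M * ∫⁻ s in Set.Ioi δ, C * ENNReal.ofReal (s ^ (d + ρ - M - 1)) := by
        gcongr 1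
        exact setLIntegral_mono' measurableSet_Ioi hswap
    _ = _ := by
        rw [lintegral_const_mul _ (by fun_prop), lintegral_Ioi_rpow (by linarith) hδ,
          ENNReal.coe_mul, ← ENNReal.ofReal]
        have : -(d + ρ - M - 1 + 1) = M - d - ρ := by ring
        rw [this, sub_add_cancel, ENNReal.ofReal_mul hM0.le, div_eq_mul_inv,
          ENNReal.ofReal_mul (by positivity)]
        ring

end WeightedVolume

/-! ### The normalized weighted measures -/

section NormalizedMeasures

lemma rpow_le_two_rpow_abs_mul {a b : ℝ} (α : ℝ) (ha : 0 < a) (hab : a ≤ b) (hb : b ≤ 2 * a) :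
    b ^ α ≤ 2 ^ |α| * a ^ α ∧ a ^ α ≤ 2 ^ |α| * b ^ α := by
  have h1 : (1 : ℝ) ≤ 2 ^ |α| := Real.one_le_rpow (by norm_num) (abs_nonneg _)
  have hb0 : 0 < b := ha.trans_le hab
  have ha' : 0 ≤ a ^ α := by positivity
  have hb' : 0 ≤ b ^ α := by positivity
  rcases le_total 0 α with h | h
  · have h2 : a ^ α ≤ b ^ α := Real.rpow_le_rpow ha.le hab h
    refine ⟨?_, by nlinarith⟩
    calc b ^ α ≤ (2 * a) ^ α := Real.rpow_le_rpow hb0.le hb h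
      _ = 2 ^ |α| * a ^ α := by rw [Real.mul_rpow (by norm_num) ha.le, abs_of_nonneg h]
  · have h2 : b ^ α ≤ a ^ α := Real.rpow_le_rpow_of_nonpos ha hab h
    refine ⟨by nlinarith, ?_⟩
    calc a ^ α = 2 ^ |α| * (2 * a) ^ α := by
          rw [Real.mul_rpow (by norm_num) ha.le, abs_of_nonpos h, ← mul_assoc,
            ← Real.rpow_add (by norm_num)]
          simp
      _ ≤ 2 ^ |α| * b ^ α := by
          gcongr ?_ * ?_
          exact Real.rpow_le_rpow_of_nonpos hb0 hb h

variable {n : ℕ}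

/-- The weights `(1 - |x|²)^α` and `(1 - |x|)^α` are comparable on `𝔹`. -/
lemma weight_comparable (α : ℝ) {x : EuclideanSpace ℝ (Fin n)} (hx : x ∈ unitBall n) :
    weight α x ≤ 2 ^ |α| * (1 - ‖x‖) ^ α ∧ (1 - ‖x‖) ^ α ≤ 2 ^ |α| * weight α x := by
  have h : ‖x‖ < 1 := by simpa [unitBall] using hx
  exact rpow_le_two_rpow_abs_mul α (by linarith) (by nlinarith [norm_nonneg x])
    (by nlinarith [norm_nonneg x])

lemma measurable_weight (α : ℝ) : Measurable (weight α : EuclideanSpace ℝ (Fin n) → ℝ) := by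
  unfold weight; fun_prop

lemma measurableSet_unitBall : MeasurableSet (unitBall n) := measurableSet_ball

lemma lintegral_nu (F : EuclideanSpace ℝ (Fin n) → ℝ≥0∞) :
    ∫⁻ x, F x ∂(nu n) = (volume (unitBall n))⁻¹ * ∫⁻ x in unitBall n, F x := by
  rw [nu, lintegral_smul_measure, smul_eq_mul]

lemma volume_unitBall_ne_zero : volume (unitBall n) ≠ 0 := (measure_ball_pos _ _ one_pos).ne'

lemma volume_unitBall_ne_top : volume (unitBall n) ≠ ∞ := measure_ball_lt_top.ne

lemma lintegral_weight_lt_top {α : ℝ} (hα : -1 < α) :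
    ∫⁻ x in unitBall n, ENNReal.ofReal (weight α x) < ∞ := by
  calc ∫⁻ x in unitBall n, ENNReal.ofReal (weight α x)
      ≤ ∫⁻ x in unitBall n, ENNReal.ofReal (2 ^ |α|) * ENNReal.ofReal ((1 - ‖x‖) ^ α) := by
        refine setLIntegral_mono' measurableSet_unitBall fun x hx => ?_
        rw [← ENNReal.ofReal_mul (by positivity)]
        exact ENNReal.ofReal_le_ofReal (weight_comparable α hx).1
    _ < ∞ := by
        rw [lintegral_const_mul' _ _ ENNReal.ofReal_ne_top]
        exact ENNReal.mul_lt_top ENNReal.ofReal_lt_top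
          (lintegral_ball_weight_lt_top volume hα)

lemma V_ne_top {α : ℝ} (hα : -1 < α) : V n α ≠ ∞ := by
  rw [V, if_pos hα, lintegral_nu]
  exact ENNReal.mul_ne_top (ENNReal.inv_ne_top.2 volume_unitBall_ne_zero)
    (lintegral_weight_lt_top hα).ne

lemma V_ne_zero {α : ℝ} (hα : -1 < α) : V n α ≠ 0 := by
  rw [V, if_pos hα, lintegral_nu]
  refine mul_ne_zero (ENNReal.inv_ne_zero.2 volume_unitBall_ne_top) fun h => ?_
  rw [setLIntegral_eq_zero_iff measurableSet_unitBall
    (measurable_weight α).ennreal_ofReal] at h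
  refine volume_unitBall_ne_zero (n := n) (measure_mono_null (fun x hx => ?_) h)
  have hx' : ‖x‖ < 1 := by simpa [unitBall] using hx
  have hpos : 0 < weight α x := Real.rpow_pos_of_pos (by nlinarith [norm_nonneg x]) _
  simpa using ⟨hx, hpos⟩

/-- The total normalizing factor of `nuWeighted`: `ν_α` is `nuFactor n α` times the measure with
density `(1 - |x|²)^α` with respect to Lebesgue measure on `𝔹`. -/
noncomputable def nuFactor (n : ℕ) (α : ℝ) : ℝ≥0∞ := (V n α)⁻¹ * (volume (unitBall n))⁻¹

lemma nuFactor_ne_top {α : ℝ} (hα : -1 < α) : nuFactor n α ≠ ∞ :=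
  ENNReal.mul_ne_top (ENNReal.inv_ne_top.2 (V_ne_zero hα))
    (ENNReal.inv_ne_top.2 volume_unitBall_ne_zero)

lemma nuFactor_ne_zero {α : ℝ} (hα : -1 < α) : nuFactor n α ≠ 0 :=
  mul_ne_zero (ENNReal.inv_ne_zero.2 (V_ne_top hα))
    (ENNReal.inv_ne_zero.2 volume_unitBall_ne_top)

lemma lintegral_nuWeighted (α : ℝ) (F : EuclideanSpace ℝ (Fin n) → ℝ≥0∞) :
    ∫⁻ x, F x ∂(nuWeighted n α) = nuFactor n α *
      ∫⁻ x in unitBall n, ENNReal.ofReal (weight α x) * F x := by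
  rw [nuWeighted, lintegral_smul_measure, smul_eq_mul,
    lintegral_withDensity_eq_lintegral_mul_non_measurable _ (measurable_weight α).ennreal_ofReal
      (Filter.Eventually.of_forall fun _ => ENNReal.ofReal_lt_top), lintegral_nu, nuFactor,
    mul_assoc]
  rfl

end NormalizedMeasures

/-! ### Size of the kernels -/

section PoleKernelBounds

variable {E : Type*} [NormedAddCommGroup E] [InnerProductSpace ℝ E]

lemma norm_planarForm_le {e e' : E} (he : ‖e‖ = 1) (he' : ‖e'‖ = 1)
    (hee' : inner ℝ e e' = (0 : ℝ)) (y : E) : ‖planarForm e e' y‖ ≤ ‖y‖ := by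
  have h1 : ‖planarForm e e' y‖ ^ 2 = (inner ℝ e y : ℝ) ^ 2 + (inner ℝ e' y : ℝ) ^ 2 := by
    rw [← Complex.normSq_eq_norm_sq, planarForm, Complex.normSq_add_mul_I]
  have horth : Orthonormal ℝ ![e, e'] := by
    constructor
    · intro i; fin_cases i <;> simp [he, he']
    · intro i j hij
      fin_cases i <;> fin_cases j <;> simp_all [real_inner_comm]
  have h2 := horth.sum_inner_products_le (s := Finset.univ) y
  simp only [Fin.sum_univ_two, Matrix.cons_val_zero, Matrix.cons_val_one, Real.norm_eq_abs,
    sq_abs] at h2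
  rw [← h1] at h2
  exact (pow_le_pow_iff_left₀ (norm_nonneg _) (norm_nonneg _) two_ne_zero).1 h2

lemma abs_inner_le_norm_planarForm (e e' y : E) : |inner ℝ e y| ≤ ‖planarForm e e' y‖ := by
  have h := Complex.abs_re_le_norm (planarForm e e' y)
  simpa [planarForm] using h

lemma norm_poleKernel (e e' b : E) (k : ℕ) (x : E) :
    ‖poleKernel e e' b k x‖ = ‖x - b‖ ^ (-((Module.finrank ℝ E : ℝ) + 2 * k + 2)) *
      ‖planarForm e e' (x - b)‖ ^ (k + 2) := by
  rw [poleKernel, norm_mul, norm_pow, Complex.norm_real, Real.norm_of_nonneg (by positivity),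
    ← Real.rpow_natCast, ← Real.rpow_mul (norm_nonneg _)]
  congr 2
  push_cast
  ring

lemma norm_poleKernel_le {e e' : E} (he : ‖e‖ = 1) (he' : ‖e'‖ = 1)
    (hee' : inner ℝ e e' = (0 : ℝ)) {b x : E} (k : ℕ) (hx : x ≠ b) :
    ‖poleKernel e e' b k x‖ ≤ ‖x - b‖ ^ (-((Module.finrank ℝ E : ℝ) + k)) := by
  have hpos : 0 < ‖x - b‖ := norm_pos_iff.2 (sub_ne_zero.2 hx)
  rw [norm_poleKernel]
  calc _ ≤ ‖x - b‖ ^ (-((Module.finrank ℝ E : ℝ) + 2 * k + 2)) * ‖x - b‖ ^ (k + 2) := by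
        gcongr
        exact norm_planarForm_le he he' hee' _
    _ = _ := by
        rw [← Real.rpow_natCast, ← Real.rpow_add hpos]
        congr 1
        push_cast
        ring

/-- Near the point `a = b - 2δe`, which lies on the axis of the kernel, the upper bound of
`norm_poleKernel_le` is attained up to a constant. -/
lemma le_norm_poleKernel {e e' a x : E} (he : ‖e‖ = 1) {δ : ℝ} (hδ : 0 < δ) (k : ℕ)
    (hx : x ∈ ball a (δ / 2)) :
    3 ^ (-((Module.finrank ℝ E : ℝ) + 2 * k + 2)) * δ ^ (-((Module.finrank ℝ E : ℝ) + k)) ≤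
      ‖poleKernel e e' (a + (2 * δ) • e) k x‖ := by
  have hxa : ‖x - a‖ < δ / 2 := by simpa [dist_eq_norm] using hx
  have hy : x - (a + (2 * δ) • e) = (x - a) - (2 * δ) • e := by abel
  have h2 : ‖(2 * δ) • e‖ = 2 * δ := by
    rw [norm_smul, he, mul_one, Real.norm_of_nonneg (by positivity)]
  have hup : ‖x - (a + (2 * δ) • e)‖ ≤ 3 * δ := by
    rw [hy]
    linarith [norm_sub_le (x - a) ((2 * δ) • e)]
  have hlow : δ ≤ ‖planarForm e e' (x - (a + (2 * δ) • e))‖ := by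
    refine le_trans ?_ (abs_inner_le_norm_planarForm _ _ _)
    rw [hy, inner_sub_right, inner_smul_right, real_inner_self_eq_norm_sq, he]
    have h3 := real_inner_le_norm e (x - a)
    rw [he, one_mul] at h3
    rw [abs_sub_comm]
    exact le_trans (by linarith) (le_abs_self _)
  have hpos : 0 < ‖x - (a + (2 * δ) • e)‖ := by
    rw [hy]
    have := norm_sub_norm_le ((2 * δ) • e) (x - a)
    rw [norm_sub_rev ((2 * δ) • e)] at this
    linarith
  rw [norm_poleKernel]
  calc _ = (3 * δ) ^ (-((Module.finrank ℝ E : ℝ) + 2 * k + 2)) * δ ^ (k + 2) := by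
        rw [Real.mul_rpow (by norm_num) hδ.le, mul_assoc, ← Real.rpow_natCast,
          ← Real.rpow_add hδ]
        congr 2
        push_cast
        ring
    _ ≤ _ := by
        gcongr ?_ * ?_
        · refine Real.rpow_le_rpow_of_nonpos hpos hup ?_
          have : (0 : ℝ) ≤ Module.finrank ℝ E := by positivity
          have : (0 : ℝ) ≤ k := by positivity
          linarith
        · gcongr

lemma exists_orthonormal_pair_of_two_le_finrank [FiniteDimensional ℝ E]
    (hE : 2 ≤ Module.finrank ℝ E) (a : E) :
    ∃ e e' : E, ‖e‖ = 1 ∧ ‖e'‖ = 1 ∧ inner ℝ e e' = (0 : ℝ) ∧ a = ‖a‖ • e := by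
  have : Nontrivial E := Module.nontrivial_of_finrank_pos (R := ℝ) (by omega)
  obtain ⟨e, he, hae⟩ : ∃ e : E, ‖e‖ = 1 ∧ a = ‖a‖ • e := by
    by_cases ha : a = 0
    · obtain ⟨e, he⟩ := exists_norm_eq E (zero_le_one' ℝ)
      exact ⟨e, he, by simp [ha]⟩
    · have : ‖a‖ ≠ 0 := norm_ne_zero_iff.2 ha
      exact ⟨‖a‖⁻¹ • a, by rw [norm_smul, norm_inv, norm_norm, inv_mul_cancel₀ this],
        by rw [smul_smul, mul_inv_cancel₀ this, one_smul]⟩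
  have he0 : e ≠ 0 := by
    rintro rfl
    simp at he
  have hne : (ℝ ∙ e)ᗮ ≠ ⊥ := by
    intro h
    have h1 := Submodule.finrank_add_finrank_orthogonal (ℝ ∙ e)
    rw [h, finrank_bot, finrank_span_singleton he0] at h1
    omega
  obtain ⟨v, hv, hv0⟩ := (Submodule.ne_bot_iff _).1 hne
  have hv1 : ‖v‖ ≠ 0 := norm_ne_zero_iff.2 hv0
  refine ⟨e, ‖v‖⁻¹ • v, he, by rw [norm_smul, norm_inv, norm_norm, inv_mul_cancel₀ hv1], ?_, hae⟩
  rw [inner_smul_right, Submodule.mem_orthogonal_singleton_iff_inner_right.1 hv, mul_zero]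

end PoleKernelBounds

/-! ### Geometric growth of Carleson measures -/

section Carleson

variable {n : ℕ} {p : ℝ≥0∞} {ρ : ℝ} {μ : Measure (EuclideanSpace ℝ (Fin n))}

lemma IsCarlesonMeasure.exists_lintegral_rpow_le (hp₀ : 0 < p) (hp : p < ∞)
    (hμ : IsCarlesonMeasure p ρ μ) :
    ∃ C : ℝ≥0, ∀ f ∈ bergmanSpace n p ρ,
      ∫⁻ x in unitBall n, ‖f x‖ₑ ^ p.toReal ∂μ ≤
        C * ∫⁻ x, ‖f x‖ₑ ^ p.toReal ∂(nuWeighted n ρ) := by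
  obtain ⟨C, hC⟩ := hμ
  have hq : 0 < p.toReal := ENNReal.toReal_pos hp₀.ne' hp.ne
  refine ⟨C ^ p.toReal, fun f hf => ?_⟩
  have h := hC f hf
  rw [bergmanNorm, eLpNorm_eq_lintegral_rpow_enorm_toReal hp₀.ne' hp.ne,
    eLpNorm_eq_lintegral_rpow_enorm_toReal hp₀.ne' hp.ne] at h
  have h2 := ENNReal.rpow_le_rpow h hq.le
  rw [ENNReal.mul_rpow_of_nonneg _ _ hq.le, ← ENNReal.rpow_mul, ← ENNReal.rpow_mul,
    one_div, inv_mul_cancel₀ hq.ne', ENNReal.rpow_one, ENNReal.rpow_one] at h2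
  rwa [ENNReal.coe_rpow_of_nonneg _ hq.le]

/-- Testing on the constant `1`. Finiteness of `μ` on `𝔹` is what Tonelli's theorem needs. -/
lemma IsCarlesonMeasure.measure_unitBall_lt_top (hρ : -1 < ρ) (hp₀ : 0 < p) (hp : p < ∞)
    (hμ : IsCarlesonMeasure p ρ μ) : μ (unitBall n) < ∞ := by
  obtain ⟨C, hC⟩ := hμ.exists_lintegral_rpow_le hp₀ hp
  have hfin : ∫⁻ _, 1 ∂(nuWeighted n ρ) < ∞ := by
    rw [lintegral_nuWeighted]
    simpa using ENNReal.mul_lt_top (nuFactor_ne_top hρ).lt_top (lintegral_weight_lt_top hρ)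
  have : IsFiniteMeasure (nuWeighted n ρ) := ⟨by simpa using hfin⟩
  have h := hC (fun _ => 1) ⟨fun x _ => harmonicAt_const 1, memLp_const 1⟩
  simp only [enorm_one, ENNReal.one_rpow, setLIntegral_one] at h
  exact h.trans_lt (ENNReal.mul_lt_top ENNReal.coe_lt_top hfin)

/-- The `p`-norms of kernels with pole at distance `δ` from `𝔹`, once the order `k` is large
enough for the kernel to be concentrated near its pole. -/
lemma exists_lintegral_poleKernel_rpow_le {q : ℝ} (hn : 2 ≤ n) (hρ : -1 < ρ) (hq : 0 < q) {k : ℕ}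
    (hk : n + ρ < (n + k) * q) :
    ∃ C : ℝ≥0, ∀ e e' : EuclideanSpace ℝ (Fin n), ‖e‖ = 1 → ‖e'‖ = 1 → inner ℝ e e' = (0 : ℝ) →
      ∀ δ : ℝ, 0 < δ → ∀ b : EuclideanSpace ℝ (Fin n), ‖b‖ = 1 + δ →
      ∫⁻ x, ‖poleKernel e e' b k x‖ₑ ^ q ∂(nuWeighted n ρ) ≤
        C * ENNReal.ofReal (δ ^ (n + ρ - (n + k) * q)) := by
  obtain ⟨C, hC⟩ := exists_lintegral_pole_weight_le
    (volume : Measure (EuclideanSpace ℝ (Fin n))) (M := (n + k) * q) hρ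
    (by rw [finrank_euclideanSpace_fin]; omega) (by rwa [finrank_euclideanSpace_fin])
  rw [finrank_euclideanSpace_fin] at hC
  refine ⟨(nuFactor n ρ).toNNReal * ((2 ^ |ρ| : ℝ).toNNReal * C),
    fun e e' he he' hee' δ hδ b hb => ?_⟩
  rw [lintegral_nuWeighted, ENNReal.coe_mul, ENNReal.coe_toNNReal (nuFactor_ne_top hρ),
    mul_assoc, ENNReal.coe_mul, ← ENNReal.ofReal]
  gcongr nuFactor n ρ * ?_
  calc ∫⁻ x in unitBall n, ENNReal.ofReal (weight ρ x) * ‖poleKernel e e' b k x‖ₑ ^ q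
      ≤ ∫⁻ x in unitBall n, ENNReal.ofReal (2 ^ |ρ|) *
          (ENNReal.ofReal (‖x - b‖ ^ (-((n + k) * q))) * ENNReal.ofReal ((1 - ‖x‖) ^ ρ)) := by
        refine setLIntegral_mono' measurableSet_unitBall fun x hx => ?_
        have hx1 : ‖x‖ < 1 := by simpa [unitBall] using hx
        have hxb : x ≠ b := by
          rintro rfl
          linarith
        have h1 := norm_poleKernel_le he he' hee' k hxb
        rw [finrank_euclideanSpace_fin] at h1
        calc ENNReal.ofReal (weight ρ x) * ‖poleKernel e e' b k x‖ₑ ^ q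
            ≤ ENNReal.ofReal (2 ^ |ρ| * (1 - ‖x‖) ^ ρ) *
              ENNReal.ofReal (‖x - b‖ ^ (-((n : ℝ) + k))) ^ q := by
              gcongr
              · exact (weight_comparable ρ hx).1
              · rw [← ofReal_norm]
                exact ENNReal.ofReal_le_ofReal h1
          _ = _ := by
              rw [ENNReal.ofReal_rpow_of_nonneg (by positivity) hq.le,
                ← Real.rpow_mul (norm_nonneg _), ENNReal.ofReal_mul (by positivity), neg_mul]
              ring
    _ ≤ _ := by
        rw [lintegral_const_mul' _ _ ENNReal.ofReal_ne_top, mul_assoc]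
        gcongr
        exact hC δ hδ b hb

/-- A `ρ`-Carleson measure gives mass `O((1 - |a|)^(n + ρ))` to the ball of centre `a` and radius
`(1 - |a|) / 2`: test the Carleson inequality on a kernel with pole at distance `1 - |a|`
from `𝔹`, on the ray through `a`. -/
theorem IsCarlesonMeasure.exists_measure_ball_le (hn : 2 ≤ n) (hρ : -1 < ρ)
    (hp₀ : 0 < p) (hp : p < ∞) (hμ : IsCarlesonMeasure p ρ μ) :
    ∃ C : ℝ≥0, ∀ a ∈ unitBall n, μ (unitBall n ∩ ball a ((1 - ‖a‖) / 2)) ≤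
      C * ENNReal.ofReal ((1 - ‖a‖) ^ (n + ρ)) := by
  have hq : 0 < p.toReal := ENNReal.toReal_pos hp₀.ne' hp.ne
  set q := p.toReal
  -- an order for which the `q`-th power of the kernel is concentrated near its pole
  obtain ⟨k, hk⟩ : ∃ k : ℕ, n + ρ < (n + k) * q := by
    obtain ⟨k, hk⟩ := exists_nat_gt ((n + ρ) / q)
    refine ⟨k, ?_⟩
    rw [div_lt_iff₀ hq] at hk
    have : 0 ≤ (n : ℝ) * q := by positivity
    linarith
  obtain ⟨C₁, hC₁⟩ := hμ.exists_lintegral_rpow_le hp₀ hp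
  obtain ⟨C₂, hC₂⟩ := exists_lintegral_poleKernel_rpow_le hn hρ hq hk
  set c : ℝ := 3 ^ (-((n : ℝ) + 2 * k + 2)) with hc
  have hc0 : 0 < c := by positivity
  refine ⟨((c ^ q)⁻¹).toNNReal * (C₁ * C₂), fun a ha => ?_⟩
  have ha1 : ‖a‖ < 1 := by simpa [unitBall] using ha
  set δ := 1 - ‖a‖ with hδdef
  have hδ : 0 < δ := by linarith
  obtain ⟨e, e', he, he', hee', hae⟩ := exists_orthonormal_pair_of_two_le_finrank
    (by rwa [finrank_euclideanSpace_fin]) a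
  -- `b = (1 + δ) e`, while `a = (1 - δ) e`
  set b := a + (2 * δ) • e with hbdef
  have hb : ‖b‖ = 1 + δ := by
    have : b = (1 + δ) • e := by
      rw [hbdef]
      nth_rewrite 1 [hae]
      rw [← add_smul]
      congr 1
      linarith
    rw [this, norm_smul, he, mul_one, Real.norm_of_nonneg (by linarith)]
  have hnorm := hC₂ e e' he he' hee' δ hδ b hb
  set f := poleKernel e e' b k with hf
  have hmem : f ∈ bergmanSpace n p ρ := by
    refine ⟨fun x hx => ?_, (measurable_poleKernel e e' b k).aestronglyMeasurable, ?_⟩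
    · refine harmonicAt_poleKernel he he' hee' k ?_
      intro h
      have : ‖x‖ < 1 := by simpa [unitBall] using hx
      rw [h, hb] at this
      linarith
    · rw [eLpNorm_lt_top_iff_lintegral_rpow_enorm_lt_top hp₀.ne' hp.ne]
      exact hnorm.trans_lt (ENNReal.mul_lt_top ENNReal.coe_lt_top ENNReal.ofReal_lt_top)
  have hlower : ENNReal.ofReal (c ^ q * δ ^ (-((n + k) * q))) *
      μ (unitBall n ∩ ball a (δ / 2)) ≤ ∫⁻ x in unitBall n, ‖f x‖ₑ ^ q ∂μ := by
    calc _ = ∫⁻ _ in unitBall n ∩ ball a (δ / 2),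
          ENNReal.ofReal (c ^ q * δ ^ (-((n + k) * q))) ∂μ := by rw [setLIntegral_const]
      _ ≤ ∫⁻ x in unitBall n ∩ ball a (δ / 2), ‖f x‖ₑ ^ q ∂μ := by
          refine setLIntegral_mono' (measurableSet_unitBall.inter measurableSet_ball)
            fun x hx => ?_
          have h1 := le_norm_poleKernel (e' := e') he hδ k hx.2
          rw [finrank_euclideanSpace_fin] at h1
          rw [← ofReal_norm, ENNReal.ofReal_rpow_of_nonneg (norm_nonneg _) hq.le]
          refine ENNReal.ofReal_le_ofReal ?_
          have h2 := Real.rpow_le_rpow (by positivity) h1 hq.le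
          rwa [Real.mul_rpow (by positivity) (by positivity), ← Real.rpow_mul hδ.le,
            neg_mul] at h2
      _ ≤ _ := lintegral_mono_set Set.inter_subset_left
  have hchain := hlower.trans ((hC₁ f hmem).trans (mul_le_mul_right hnorm (C₁ : ℝ≥0∞)))
  have hfac : ENNReal.ofReal (c ^ q * δ ^ (-((n + k) * q))) *
      (((((c ^ q)⁻¹).toNNReal * (C₁ * C₂) : ℝ≥0) : ℝ≥0∞) * ENNReal.ofReal (δ ^ (n + ρ))) =
      C₁ * (C₂ * ENNReal.ofReal (δ ^ (n + ρ - (n + k) * q))) := by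
    have : δ ^ (n + ρ - (n + k) * q) = (c ^ q * δ ^ (-((n + k) * q))) * (c ^ q)⁻¹ *
        δ ^ (n + ρ) := by
      rw [sub_eq_add_neg, Real.rpow_add hδ]
      field_simp
    rw [this, ENNReal.ofReal_mul (q := δ ^ (n + ρ)) (by positivity),
      ENNReal.ofReal_mul (q := (c ^ q)⁻¹) (by positivity),
      ENNReal.coe_mul, ENNReal.coe_mul, ← ENNReal.ofReal]
    ring
  refine (ENNReal.mul_le_mul_iff_right ?_ ENNReal.ofReal_ne_top).1 (hchain.trans hfac.ge)
  rw [ne_eq, ENNReal.ofReal_eq_zero, not_le]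
  positivity

end Carleson

/-! ### Pointwise bounds for harmonic functions on the ball -/

section PointwiseBounds

variable {n : ℕ}

lemma integral_radialBump_pos {E : Type*} [NormedAddCommGroup E] [InnerProductSpace ℝ E]
    [FiniteDimensional ℝ E] [MeasurableSpace E] [BorelSpace E]
    (μ : Measure E) [μ.IsAddHaarMeasure] : 0 < ∫ z : E, radialBump 2 z ∂μ := by
  refine (continuous_radialBump 2).integral_pos_of_hasCompactSupport_nonneg_nonzero
    (x := (0 : E)) ?_ (fun z => radialBump_nonneg 2 z) ?_
  · exact HasCompactSupport.of_support_subset_isCompact (isCompact_closedBall 0 1)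
      ((support_radialBump_subset two_ne_zero).trans ball_subset_closedBall)
  · simp [radialBump]

lemma measurable_indicator_of_harmonic {g : EuclideanSpace ℝ (Fin n) → ℂ}
    (hg : g ∈ harmonicFunctions n) : Measurable ((unitBall n).indicator g) := by
  classical
  rw [← Set.piecewise_eq_indicator]
  exact (HarmonicOnNhd.continuousOn hg).measurable_piecewise continuousOn_const
    measurableSet_unitBall

/-- The sub-mean value property of `|g|` on the ball of centre `x` and radius `(1 - |x|) / 4`. -/
lemma exists_enorm_le_lintegral_ball (n : ℕ) :
    ∃ C : ℝ≥0, ∀ g ∈ harmonicFunctions n, ∀ x ∈ unitBall n,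
      ‖g x‖ₑ ≤ C * ENNReal.ofReal ((1 - ‖x‖) ^ (-(n : ℝ))) *
        ∫⁻ y in ball x ((1 - ‖x‖) / 4), ‖g y‖ₑ := by
  set I : ℝ := ∫ z : EuclideanSpace ℝ (Fin n), radialBump 2 z with hI
  have hI0 : 0 < I := integral_radialBump_pos _
  refine ⟨(I⁻¹ * 4 ^ n).toNNReal, fun g hg x hx => ?_⟩
  have hx1 : ‖x‖ < 1 := by simpa [unitBall] using hx
  set δ := 1 - ‖x‖ with hδ
  have hδ0 : 0 < δ := by linarith
  set t := δ / 4 with ht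
  have ht0 : 0 < t := by positivity
  have hsub : ball x δ ⊆ unitBall n := ball_subset_ball' (by rw [dist_zero_right]; linarith)
  have hsub' : ball x t ⊆ unitBall n := (ball_subset_ball (by linarith)).trans hsub
  have hmv := integral_radialBump_smul_eq (volume : Measure (EuclideanSpace ℝ (Fin n)))
    (HarmonicOnNhd.mono hg hsub) ht0.le (by linarith : t < δ)
  rw [← hI] at hmv
  let G : EuclideanSpace ℝ (Fin n) → ℝ≥0∞ := (ball x t).indicator fun y => ‖g y‖ₑ
  have hG : Measurable G := by
    have : G = (ball x t).indicator fun y => ‖(unitBall n).indicator g y‖ₑ := by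
      ext y
      by_cases hy : y ∈ ball x t
      · simp only [G, Set.indicator_of_mem hy, Set.indicator_of_mem (hsub' hy)]
      · simp only [G, Set.indicator_of_notMem hy]
    rw [this]
    exact (measurable_indicator_of_harmonic hg).enorm.indicator measurableSet_ball
  have h1 : ENNReal.ofReal I * ‖g x‖ₑ ≤ ∫⁻ z, G (x + t • z) := by
    calc ENNReal.ofReal I * ‖g x‖ₑ = ‖I • g x‖ₑ := by
          rw [enorm_smul, ← ofReal_norm I, Real.norm_of_nonneg hI0.le]
      _ ≤ ∫⁻ z, ‖radialBump 2 z • g (x + t • z)‖ₑ := by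
          rw [← hmv]
          exact enorm_integral_le_lintegral_enorm _
      _ ≤ _ := by
          refine lintegral_mono fun z => ?_
          by_cases hz : ‖z‖ < 1
          · have hmem : x + t • z ∈ ball x t := by
              rw [mem_ball, dist_self_add_left, norm_smul, Real.norm_of_nonneg ht0.le]
              nlinarith
            simp only [G]
            rw [Set.indicator_of_mem hmem, enorm_smul, ← ofReal_norm (radialBump 2 z),
              Real.norm_of_nonneg (radialBump_nonneg 2 z)]
            calc _ ≤ 1 * ‖g (x + t • z)‖ₑ := by
                  gcongr
                  rw [← ENNReal.ofReal_one]
                  exact ENNReal.ofReal_le_ofReal (radialBump_le_one 2 z)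
              _ = _ := one_mul _
          · rw [radialBump_eq_zero two_ne_zero (not_lt.1 hz)]
            simp
  have h2 : ∫⁻ y in ball x t, ‖g y‖ₑ = ENNReal.ofReal (t ^ n) * ∫⁻ z, G (x + t • z) := by
    have h3 := lintegral_eq_mul_lintegral_comp_smul volume ht0
      (hG.comp (measurable_const_add x))
    rw [finrank_euclideanSpace_fin] at h3
    rw [← lintegral_indicator measurableSet_ball, ← lintegral_add_left_eq_self _ x]
    exact h3
  rw [h2, ← ENNReal.ofReal, ← ENNReal.ofReal_mul (by positivity), ← mul_assoc,
    ← ENNReal.ofReal_mul (by positivity)]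
  have hc : I⁻¹ * 4 ^ n * δ ^ (-(n : ℝ)) * t ^ n = I⁻¹ := by
    rw [ht, Real.rpow_neg hδ0.le, Real.rpow_natCast, div_pow]
    field_simp
  rw [hc]
  calc ‖g x‖ₑ = ENNReal.ofReal I⁻¹ * (ENNReal.ofReal I * ‖g x‖ₑ) := by
        rw [← mul_assoc, ← ENNReal.ofReal_mul (by positivity), inv_mul_cancel₀ hI0.ne',
          ENNReal.ofReal_one, one_mul]
    _ ≤ _ := by gcongr

/-- By continuity, the essential supremum `blochNorm` bounds the weighted function at every
point of `𝔹`. -/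
lemma weight_mul_enorm_le_blochNorm (α : ℝ) {f : EuclideanSpace ℝ (Fin n) → ℂ}
    (hf : f ∈ harmonicFunctions n) {x : EuclideanSpace ℝ (Fin n)} (hx : x ∈ unitBall n) :
    ENNReal.ofReal (weight α x) * ‖f x‖ₑ ≤ blochNorm α f := by
  have hpos : ∀ y ∈ unitBall n, 0 < 1 - ‖y‖ ^ 2 := by
    intro y hy
    have : ‖y‖ < 1 := by simpa [unitBall] using hy
    nlinarith [norm_nonneg y]
  have hcont : ContinuousOn (fun y => ‖weight α y • f y‖ₑ) (unitBall n) := by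
    have hw : ContinuousOn (weight α) (unitBall n) :=
      ContinuousOn.rpow_const (by fun_prop) fun y hy => Or.inl (hpos y hy).ne'
    have hwf : ContinuousOn (fun y => weight α y • f y) (unitBall n) :=
      hw.smul (HarmonicOnNhd.continuousOn hf)
    exact continuous_enorm.comp_continuousOn hwf
  have hae : ∀ᵐ y ∂(nu n), ‖weight α y • f y‖ₑ ≤ blochNorm α f := by
    rw [blochNorm, eLpNorm_exponent_top]
    exact enorm_ae_le_eLpNormEssSup _ _
  rw [nu, Measure.ae_ennreal_smul_measure_iff
    (ENNReal.inv_ne_zero.2 volume_unitBall_ne_top)] at hae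
  have hopen : IsOpen (unitBall n ∩ (fun y => ‖weight α y • f y‖ₑ) ⁻¹' Set.Ioi (blochNorm α f)) :=
    hcont.isOpen_inter_preimage isOpen_ball isOpen_Ioi
  have hnull : volume (unitBall n ∩ (fun y => ‖weight α y • f y‖ₑ) ⁻¹'
      Set.Ioi (blochNorm α f)) = 0 := by
    rw [ae_restrict_iff' measurableSet_unitBall] at hae
    refine measure_mono_null (fun y hy => ?_) hae
    intro h
    exact absurd (h hy.1) (not_le.2 hy.2)
  have hempty := hopen.measure_eq_zero_iff volume |>.1 hnull
  have hle : ‖weight α x • f x‖ₑ ≤ blochNorm α f := by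
    by_contra! h
    exact Set.eq_empty_iff_forall_notMem.1 hempty x ⟨hx, h⟩
  have hw0 : 0 ≤ weight α x := Real.rpow_nonneg (hpos x hx).le _
  rwa [enorm_smul, ← ofReal_norm (weight α x), Real.norm_of_nonneg hw0] at hle

end PointwiseBounds

/-! ### The product estimate -/

section MainEstimate

variable {n : ℕ}

/-- If `μ` has the growth of a `(α₁ + α₂)`-Carleson measure on the balls
`B(a, (1 - |a|) / 2)`, then `(1 - |x|)^(-α₁) dμ` embeds `b¹_{α₂}` into `L¹`. The sub-mean value
property and Tonelli's theorem transfer the integral from `μ` to Lebesgue measure. -/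
theorem exists_lintegral_rpow_mul_le {μ : Measure (EuclideanSpace ℝ (Fin n))} {α₁ α₂ : ℝ}
    (hα₁ : 0 < α₁) (hα₂ : -1 < α₂) (hfin : μ (unitBall n) < ∞) {C₀ : ℝ≥0}
    (hC₀ : ∀ a ∈ unitBall n, μ (unitBall n ∩ ball a ((1 - ‖a‖) / 2)) ≤
      C₀ * ENNReal.ofReal ((1 - ‖a‖) ^ (n + (α₁ + α₂)))) :
    ∃ C : ℝ≥0, ∀ g ∈ harmonicFunctions n,
      ∫⁻ x in unitBall n, ENNReal.ofReal ((1 - ‖x‖) ^ (-α₁)) * ‖g x‖ₑ ∂μ ≤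
        C * bergmanNorm 1 α₂ g := by
  obtain ⟨C₁, hC₁⟩ := exists_enorm_le_lintegral_ball n
  have hF := nuFactor_ne_zero (n := n) hα₂
  have hF' := nuFactor_ne_top (n := n) hα₂
  set A : ℝ := 2 ^ (α₁ + n) with hA
  refine ⟨C₁ * A.toNNReal * C₀ * ((2 : ℝ) ^ |α₂|).toNNReal * (nuFactor n α₂)⁻¹.toNNReal,
    fun g hg => ?_⟩
  have : IsFiniteMeasure (μ.restrict (unitBall n)) := ⟨by simpa using hfin⟩
  let h : EuclideanSpace ℝ (Fin n) → ℝ≥0∞ := fun y =>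
    ENNReal.ofReal ((1 - ‖y‖) ^ (-(α₁ + n))) * ‖(unitBall n).indicator g y‖ₑ
  have hh : Measurable h :=
    Measurable.mul (by fun_prop) (measurable_indicator_of_harmonic hg).enorm
  -- `|x - y| < (1 - |x|) / 4` implies the condition `|x - y| < (1 - |y|) / 2`, whose `x`-section
  -- is a ball to which the bound on `μ` applies
  let K : EuclideanSpace ℝ (Fin n) → EuclideanSpace ℝ (Fin n) → ℝ≥0∞ := fun x y =>
    if dist x y < (1 - ‖y‖) / 2 then h y else 0
  have hK : Measurable (Function.uncurry K) :=
    Measurable.ite (measurableSet_lt (by fun_prop) (by fun_prop)) (hh.comp measurable_snd)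
      measurable_const
  have hpt : ∀ x ∈ unitBall n, ENNReal.ofReal ((1 - ‖x‖) ^ (-α₁)) * ‖g x‖ₑ ≤
      C₁ * ENNReal.ofReal A * ∫⁻ y in unitBall n, K x y := by
    intro x hx
    have hx1 : ‖x‖ < 1 := by simpa [unitBall] using hx
    have hδ : 0 < 1 - ‖x‖ := by linarith
    have hsub : ball x ((1 - ‖x‖) / 4) ⊆ unitBall n :=
      ball_subset_ball' (by rw [dist_zero_right]; linarith)
    calc ENNReal.ofReal ((1 - ‖x‖) ^ (-α₁)) * ‖g x‖ₑ
        ≤ ENNReal.ofReal ((1 - ‖x‖) ^ (-α₁)) * (C₁ * ENNReal.ofReal ((1 - ‖x‖) ^ (-(n : ℝ))) *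
            ∫⁻ y in ball x ((1 - ‖x‖) / 4), ‖g y‖ₑ) := by
          gcongr
          exact hC₁ g hg x hx
      _ = C₁ * ∫⁻ y in ball x ((1 - ‖x‖) / 4),
            ENNReal.ofReal ((1 - ‖x‖) ^ (-(α₁ + n))) * ‖g y‖ₑ := by
          rw [lintegral_const_mul' _ _ ENNReal.ofReal_ne_top, neg_add, Real.rpow_add hδ,
            ENNReal.ofReal_mul (by positivity)]
          ring
      _ ≤ C₁ * ∫⁻ y in ball x ((1 - ‖x‖) / 4), ENNReal.ofReal A * K x y := by
          gcongr 1
          refine setLIntegral_mono' measurableSet_ball fun y hy => ?_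
          have hd : ‖y - x‖ < (1 - ‖x‖) / 4 := by simpa [dist_eq_norm] using hy
          have h1 := norm_sub_norm_le y x
          have h2 := norm_sub_norm_le x y
          rw [norm_sub_rev] at h2
          have hlt : dist x y < (1 - ‖y‖) / 2 := by
            rw [dist_eq_norm, norm_sub_rev]
            linarith
          simp only [K, h]
          rw [if_pos hlt, Set.indicator_of_mem (hsub hy), ← mul_assoc,
            ← ENNReal.ofReal_mul (by positivity)]
          gcongr
          have hy0 : 0 < 1 - ‖y‖ := by linarith [norm_nonneg (y - x)]
          calc (1 - ‖x‖) ^ (-(α₁ + n)) ≤ ((1 - ‖y‖) / 2) ^ (-(α₁ + n)) :=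
                Real.rpow_le_rpow_of_nonpos (by linarith) (by linarith)
                  (by have : (0 : ℝ) ≤ n := by positivity
                      linarith)
            _ = A * (1 - ‖y‖) ^ (-(α₁ + n)) := by
                rw [Real.div_rpow hy0.le (by norm_num), Real.rpow_neg (by norm_num : (0 : ℝ) ≤ 2),
                  hA]
                field_simp
      _ ≤ C₁ * ∫⁻ y in unitBall n, ENNReal.ofReal A * K x y := by
          gcongr 1
          exact lintegral_mono_set hsub
      _ = _ := by
          rw [lintegral_const_mul' _ _ ENNReal.ofReal_ne_top, mul_assoc]
  have hinner : ∀ y ∈ unitBall n, ∫⁻ x in unitBall n, K x y ∂μ ≤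
      C₀ * ENNReal.ofReal (2 ^ |α₂|) * (ENNReal.ofReal (weight α₂ y) * ‖g y‖ₑ) := by
    intro y hy
    have hy1 : ‖y‖ < 1 := by simpa [unitBall] using hy
    have hδ : 0 < 1 - ‖y‖ := by linarith
    have hind : ∀ x, K x y = (ball y ((1 - ‖y‖) / 2)).indicator (fun _ => h y) x := by
      intro x
      by_cases hxy : dist x y < (1 - ‖y‖) / 2
      · rw [Set.indicator_of_mem (by exact hxy)]
        exact if_pos hxy
      · rw [Set.indicator_of_notMem (by exact hxy)]
        exact if_neg hxy
    rw [lintegral_congr hind, setLIntegral_indicator measurableSet_ball, setLIntegral_const,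
      Set.inter_comm]
    calc h y * μ (unitBall n ∩ ball y ((1 - ‖y‖) / 2))
        ≤ h y * (C₀ * ENNReal.ofReal ((1 - ‖y‖) ^ (n + (α₁ + α₂)))) := by
          gcongr
          exact hC₀ y hy
      _ = C₀ * (ENNReal.ofReal ((1 - ‖y‖) ^ α₂) * ‖g y‖ₑ) := by
          have he : α₂ = -(α₁ + n) + (n + (α₁ + α₂)) := by ring
          conv_rhs => rw [he, Real.rpow_add hδ, ENNReal.ofReal_mul (by positivity)]
          simp only [h]
          rw [Set.indicator_of_mem hy]
          ring
      _ ≤ C₀ * (ENNReal.ofReal (2 ^ |α₂| * weight α₂ y) * ‖g y‖ₑ) := by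
          gcongr
          exact (weight_comparable α₂ hy).2
      _ = _ := by
          rw [ENNReal.ofReal_mul (by positivity)]
          ring
  have hnorm : ∫⁻ y in unitBall n, ENNReal.ofReal (weight α₂ y) * ‖g y‖ₑ =
      (nuFactor n α₂)⁻¹ * bergmanNorm 1 α₂ g := by
    rw [bergmanNorm, eLpNorm_one_eq_lintegral_enorm, lintegral_nuWeighted, ← mul_assoc,
      ENNReal.inv_mul_cancel hF hF', one_mul]
  calc ∫⁻ x in unitBall n, ENNReal.ofReal ((1 - ‖x‖) ^ (-α₁)) * ‖g x‖ₑ ∂μ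
      ≤ ∫⁻ x in unitBall n, C₁ * ENNReal.ofReal A * (∫⁻ y in unitBall n, K x y) ∂μ :=
        setLIntegral_mono' measurableSet_unitBall hpt
    _ = C₁ * ENNReal.ofReal A * ∫⁻ y in unitBall n, ∫⁻ x in unitBall n, K x y ∂μ := by
        rw [lintegral_const_mul' _ _ (ENNReal.mul_ne_top ENNReal.coe_ne_top ENNReal.ofReal_ne_top),
          lintegral_lintegral_swap hK.aemeasurable]
    _ ≤ C₁ * ENNReal.ofReal A * ∫⁻ y in unitBall n,
          C₀ * ENNReal.ofReal (2 ^ |α₂|) * (ENNReal.ofReal (weight α₂ y) * ‖g y‖ₑ) := by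
        gcongr 1
        exact setLIntegral_mono' measurableSet_unitBall hinner
    _ = _ := by
        rw [lintegral_const_mul' _ _
          (ENNReal.mul_ne_top ENNReal.coe_ne_top ENNReal.ofReal_ne_top), hnorm]
        simp only [ENNReal.coe_mul, ENNReal.coe_toNNReal (ENNReal.inv_ne_top.2 hF),
          ← ENNReal.ofReal.eq_1]
        ring

lemma enorm_le_blochNorm_mul {α : ℝ} (hα : 0 < α) {f : EuclideanSpace ℝ (Fin n) → ℂ}
    (hf : f ∈ harmonicFunctions n) {x : EuclideanSpace ℝ (Fin n)} (hx : x ∈ unitBall n) :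
    ‖f x‖ₑ ≤ blochNorm α f * ENNReal.ofReal ((1 - ‖x‖) ^ (-α)) := by
  have hx1 : ‖x‖ < 1 := by simpa [unitBall] using hx
  have hδ : 0 < 1 - ‖x‖ := by linarith
  calc ‖f x‖ₑ = ENNReal.ofReal ((1 - ‖x‖) ^ α) * ‖f x‖ₑ *
        ENNReal.ofReal ((1 - ‖x‖) ^ (-α)) := by
        rw [mul_right_comm, ← ENNReal.ofReal_mul (by positivity), ← Real.rpow_add hδ]
        simp
    _ ≤ ENNReal.ofReal (weight α x) * ‖f x‖ₑ * ENNReal.ofReal ((1 - ‖x‖) ^ (-α)) := by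
        gcongr
        exact Real.rpow_le_rpow hδ.le (by nlinarith [norm_nonneg x]) hα.le
    _ ≤ _ := by
        gcongr
        exact weight_mul_enorm_le_blochNorm α hf hx

end MainEstimate

end HarmonicBall

theorem proposition3p2 (n : ℕ) (hn : 2 ≤ n)
    (μ : MeasureTheory.Measure (EuclideanSpace ℝ (Fin n)))
    (α₁ α₂ ϱ : ℝ) (hα₁ : 0 < α₁) (hα₂ : -1 < α₂) (hϱ : ϱ = α₁ + α₂)
    (p : ℝ≥0∞) (hp₀ : 0 < p) (hp : p < ∞)
    (hμ : HarmonicBall.IsCarlesonMeasure p ϱ μ) :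
    ∃ C : ℝ≥0, 0 < C ∧
      ∀ f ∈ HarmonicBall.blochSpace n α₁, ∀ g ∈ HarmonicBall.bergmanSpace n 1 α₂,
        ∫⁻ x in HarmonicBall.unitBall n, ‖f x‖ₑ * ‖g x‖ₑ ∂μ ≤
          C * HarmonicBall.blochNorm α₁ f * HarmonicBall.bergmanNorm 1 α₂ g := by
  have hϱ1 : -1 < ϱ := by linarith
  obtain ⟨C₀, hC₀⟩ := hμ.exists_measure_ball_le hn hϱ1 hp₀ hp
  have hfin := hμ.measure_unitBall_lt_top hϱ1 hp₀ hp
  subst hϱ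
  obtain ⟨C, hC⟩ := HarmonicBall.exists_lintegral_rpow_mul_le hα₁ hα₂ hfin hC₀
  refine ⟨C + 1, by positivity, fun f hf g hg => ?_⟩
  have hN : HarmonicBall.blochNorm α₁ f ≠ ∞ := hf.2.eLpNorm_ne_top
  calc ∫⁻ x in HarmonicBall.unitBall n, ‖f x‖ₑ * ‖g x‖ₑ ∂μ
      ≤ ∫⁻ x in HarmonicBall.unitBall n, HarmonicBall.blochNorm α₁ f *
          (ENNReal.ofReal ((1 - ‖x‖) ^ (-α₁)) * ‖g x‖ₑ) ∂μ := by
        refine setLIntegral_mono' HarmonicBall.measurableSet_unitBall fun x hx => ?_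
        rw [← mul_assoc]
        gcongr
        exact HarmonicBall.enorm_le_blochNorm_mul hα₁ hf.1 hx
    _ = HarmonicBall.blochNorm α₁ f * ∫⁻ x in HarmonicBall.unitBall n,
          ENNReal.ofReal ((1 - ‖x‖) ^ (-α₁)) * ‖g x‖ₑ ∂μ := lintegral_const_mul' _ _ hN
    _ ≤ HarmonicBall.blochNorm α₁ f * (C * HarmonicBall.bergmanNorm 1 α₂ g) := by
        gcongr
        exact hC g hg.1
    _ = C * HarmonicBall.blochNorm α₁ f * HarmonicBall.bergmanNorm 1 α₂ g := by ring
    _ ≤ _ := by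
        gcongr
        exact le_self_add
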